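/- **Universality of R-SympNets.** Write $x=(p,q)\in\mathbb{R}^{2n}$, $J=\begin{pmatrix}O&-I\\ I&O\end{pmatrix}$, and for $H\in C^1(\mathbb{R}^{2n})$ let $X_H=J\nabla H$. For $h\in\mathbb{R}$ and $D\subset\mathbb{R}^{2n}$ we say that $\phi^H_h$ is the time-$h$ Hamiltonian flow of $H$ on $D$ if for every $x\in D$ the initial value problem $\dot\gamma=X_H(\gamma)$, $\gamma(0)=x$, has a solution on the closed time interval between $0$ and $h$, this solution is unique (also on every shorter closed interval between $0$ and a $\tau$ between $0$ and $h$), and $\phi^H_h(x)=\gamma(h)$. Let $\sigma\in C^1(\mathbb{R})$ be an activation function that is not a polynomial (for instance, any bounded non-constant $\sigma\in C^1(\mathbb{R})$). An R-SympNet of width $m$ with $k\ge1$ layers and time step $h$ is a map $\Phi=\phi^{H_k}_h\circ\dots\circ\phi^{H_1}_h$, where each $\phi^{H_i}_h$ is the exact time-$h$ Hamiltonian flow on $\mathbb{R}^{2n}$ of a function $H_i$ from $$\mathcal{H}=\Big\{x\mapsto\sum_{j=1}^m a_j\,\sigma(w^Tx+b_j)\ :\ a,b\in\mathbb{R}^m,\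 w\in\mathbb{R}^{2n}\Big\}.$$ Then for every width $m\ge1$, every $H\in C^1(\mathbb{R}^{2n})$, every $h\in\mathbb{R}$, every compact $\Omega\subset\mathbb{R}^{2n}$ on which the time-$h$ flow $\phi^H_h$ is defined, and every $\epsilon>0$, there exist a number $k\ge 1$ of layers and an R-SympNet $\Phi$ of width $m$ with $k$ layers, activation $\sigma$ and time step $h$ such that $$\|\Phi(x)-\phi^H_h(x)\|<\epsilon\qquad\text{for all }x\in\Omega .$$ -/

import Mathlib

/-- The phase space `ℝ²ⁿ` with its Euclidean norm. A point is `x = (p, q)`: the coordinates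
indexed by `Sum.inl i` are the momenta `pᵢ`, those indexed by `Sum.inr i` the positions `qᵢ`. -/
abbrev PhaseSpace (n : ℕ) : Type := EuclideanSpace ℝ (Fin n ⊕ Fin n)

/-- The Hamiltonian vector field `X_H = J ∇H`, where `J = (O, -I; I, O)`. -/
noncomputable def hamiltonianField {n : ℕ} (H : PhaseSpace n → ℝ) :
    PhaseSpace n → PhaseSpace n :=
  fun x => Matrix.toEuclideanLin (Matrix.J (Fin n) ℝ) (gradient H x)

/-- `φ` is the time-`h` flow `φ^H_h` on the set `D`: from every `x ∈ D` the solution of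
`ẋ = X_H(x)` exists on the whole time interval between `0` and `h` and is unique (on every shorter
time interval too), and `φ x` is its value at time `h`. -/
def IsHamiltonianFlow {n : ℕ} (H : PhaseSpace n → ℝ) (h : ℝ) (D : Set (PhaseSpace n))
    (φ : PhaseSpace n → PhaseSpace n) : Prop :=
  ∀ x ∈ D,
    (∃ γ : ℝ → PhaseSpace n, γ 0 = x ∧ γ h = φ x ∧
      IsIntegralCurveOn γ (fun _ => hamiltonianField H) (Set.uIcc 0 h)) ∧
    (∀ τ ∈ Set.uIcc 0 h, ∀ γ₁ γ₂ : ℝ → PhaseSpace n, γ₁ 0 = x → γ₂ 0 = x →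
      IsIntegralCurveOn γ₁ (fun _ => hamiltonianField H) (Set.uIcc 0 τ) →
      IsIntegralCurveOn γ₂ (fun _ => hamiltonianField H) (Set.uIcc 0 τ) →
      Set.EqOn γ₁ γ₂ (Set.uIcc 0 τ))

/-- `IsSympNet ℋ h k Φ`: the map `Φ` is a symplectic neural network with `k ≥ 1` layers and time
step `h` over the generating set `ℋ` of Hamiltonians, i.e. `Φ = φ^{H_k}_h ∘ ⋯ ∘ φ^{H_1}_h` with all
`H_i ∈ ℋ`, where `φ^{H_i}_h` is the exact Hamiltonian flow on all of `ℝ²ⁿ`. -/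
inductive IsSympNet {n : ℕ} (ℋ : Set (PhaseSpace n → ℝ)) (h : ℝ) :
    ℕ → (PhaseSpace n → PhaseSpace n) → Prop
  | single {H : PhaseSpace n → ℝ} {φ : PhaseSpace n → PhaseSpace n} :
      H ∈ ℋ → IsHamiltonianFlow H h Set.univ φ → IsSympNet ℋ h 1 φ
  | comp {k : ℕ} {Φ φ : PhaseSpace n → PhaseSpace n} {H : PhaseSpace n → ℝ} :
      IsSympNet ℋ h k Φ → H ∈ ℋ → IsHamiltonianFlow H h Set.univ φ →
      IsSympNet ℋ h (k + 1) (φ ∘ Φ)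

/-- The generating Hamiltonians of R-SympNets of width `m` with activation `σ`: the functions
`x ↦ ∑ i, aᵢ σ(wᵀx + bᵢ)` with `a, b ∈ ℝᵐ` and one direction `w ∈ ℝ²ⁿ`. -/
def ridgeHamiltonians (n : ℕ) (σ : ℝ → ℝ) (m : ℕ) : Set (PhaseSpace n → ℝ) :=
  {H | ∃ (a b : Fin m → ℝ) (w : PhaseSpace n),
    H = fun x => ∑ i, a i * σ (inner ℝ w x + b i)}

/-- `Φ` is an R-SympNet of width `m` with `k` layers, activation `σ` and time step `h`. -/
def IsRSympNet {n : ℕ} (σ : ℝ → ℝ) (m : ℕ) (h : ℝ) (k : ℕ)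
    (Φ : PhaseSpace n → PhaseSpace n) : Prop :=
  IsSympNet (ridgeHamiltonians n σ m) h k Φ

/-!
The argument combines a convergence theorem for one-step methods that needs no Lipschitz condition
with a universal approximation theorem for gradients.

**Layers are shears.** Along an integral curve of `a σ(wᵀx + b)` the quantity `wᵀx` is constant,
because `w ⟂ J w`. Hence the time-`h` flow is `x ↦ x + h a σ'(wᵀx + b) J w`
(`isHamiltonianFlow_ridge`). For `h ≠ 0` the free weight `a` absorbs `h`, so every shear
`x ↦ x + s σ'(wᵀx + b) J w`, `s ∈ ℝ`, is a layer, whatever the width, and networks are closed under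
composition.

**Gradients are limits of ridge fields.** Put `g = σ'`, which is continuous and not a polynomial.
On a bounded interval the closed span of the functions `y ↦ g (λ y + b)`, `λ ≠ 0`, contains the
same functions formed with a mollification `ψ` of `g`. For every `k` some `ψ` has `ψ⁽ᵏ⁾(b) ≠ 0` for
some `b`, since otherwise `g` would be a limit of polynomials of degree less than `k`; Taylor's
formula at `b`, as `λ → 0`, then shows by induction that all monomials lie in the closed span
(`monomialOn_mem_dilateSpan`), and so does every continuous function. In particular the fields
`x ↦ exp ⟪w, x⟫ w` are limits of ridge fields. For a compactly supported `C¹` function `H` the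
gradient is close to its convolution with a bump, the bump is close to a finite sum `P` of
exponentials by the Stone–Weierstrass theorem, and after an integration by parts the convolution
of `P` with `∇H` is a finite sum of fields `d exp ⟪w, x⟫ w`
(`isRidgeLimit_gradient_of_hasCompactSupport`).

**Consistent one-step methods converge.** If `G` is a linear combination of ridge fields, composing
the shears of its terms gives a network with `Ψ(x) = x + τ J G(x) + o(τ)`, uniformly on bounded sets
(`exists_isRSympNet_isConsistent`). Iterating such maps `N` times with step `1 / N` follows the
flow of `X_H` even though `X_H` is merely continuous: along an ultrafilter, discrete orbits with
steps and errors tending to zero converge to an integral curve, and there is only one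
(`exists_approx_euler_close`). The hypothesis of uniqueness on shorter intervals keeps the orbits in
a bounded region, and compactness of `Ω` makes the estimate uniform
(`exists_iterate_close_of_isCompact`).
-/

/-! ### Discrete approximate orbits of a continuous vector field -/

section FlowApproximation

open Filter Topology

variable {E : Type*} [NormedAddCommGroup E] [NormedSpace ℝ E]

/-- An approximate Euler orbit of a field bounded by `M` is Lipschitz in discrete time. -/
theorem norm_sub_le_of_approx_euler {X : E → E} {M δ : ℝ} (hM : ∀ x, ‖X x‖ ≤ M)
    {N : ℕ} {y : ℕ → E}
    (hy : ∀ i < N, ‖y (i + 1) - y i - (1 / N : ℝ) • X (y i)‖ ≤ δ / N)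
    {i j : ℕ} (hij : i ≤ j) (hj : j ≤ N) :
    ‖y j - y i‖ ≤ (M + δ) * ((j - i : ℝ) / N) := by
  induction j, hij using Nat.le_induction with
  | base => simp
  | succ j hij ih =>
    have h1 := ih (by omega)
    have h2 := hy j (by omega)
    have h3 : ‖(1 / N : ℝ) • X (y j)‖ ≤ M / N := by
      rw [norm_smul, Real.norm_of_nonneg (by positivity), one_div_mul_eq_div]
      gcongr
      exact hM _
    have h4 : y (j + 1) - y i
        = (y (j + 1) - y j - (1 / N : ℝ) • X (y j)) + (1 / N : ℝ) • X (y j) + (y j - y i) := by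
      abel
    rw [h4]
    refine (norm_add₃_le).trans ?_
    calc _ ≤ δ / N + M / N + (M + δ) * ((j - i : ℝ) / N) := by gcongr
      _ = _ := by push_cast; ring

/-- Over a time span so short that the field varies by at most `η`, an approximate Euler orbit
advances along its initial velocity up to a relative error `η + δ`. -/
theorem norm_sub_sub_smul_le_of_approx_euler {X : E → E} {M δ η ρ : ℝ}
    (hM : ∀ x, ‖X x‖ ≤ M) (hM0 : 0 ≤ M) (hδ : 0 ≤ δ)
    (hX : ∀ a b, ‖a - b‖ ≤ ρ → ‖X a - X b‖ ≤ η)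
    {N : ℕ} {y : ℕ → E}
    (hy : ∀ i < N, ‖y (i + 1) - y i - (1 / N : ℝ) • X (y i)‖ ≤ δ / N)
    {i j : ℕ} (hij : i ≤ j) (hj : j ≤ N) (hρ : (M + δ) * ((j - i : ℝ) / N) ≤ ρ) :
    ‖y j - y i - ((j - i : ℝ) / N) • X (y i)‖ ≤ (η + δ) * ((j - i : ℝ) / N) := by
  induction j, hij using Nat.le_induction with
  | base => simp
  | succ j hij ih =>
    have hle : (M + δ) * ((j - i : ℝ) / N) ≤ ρ := by
      refine le_trans ?_ hρ
      push_cast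
      gcongr
      linarith
    have h1 := ih (by omega) hle
    have h2 := hy j (by omega)
    have h3 : ‖(1 / N : ℝ) • (X (y j) - X (y i))‖ ≤ η / N := by
      rw [norm_smul, Real.norm_of_nonneg (by positivity), one_div_mul_eq_div]
      gcongr
      exact hX _ _ ((norm_sub_le_of_approx_euler hM hy hij (by omega)).trans hle)
    have h4 : y (j + 1) - y i - (((j + 1 : ℕ) - i : ℝ) / N) • X (y i)
        = (y (j + 1) - y j - (1 / N : ℝ) • X (y j)) + (1 / N : ℝ) • (X (y j) - X (y i))
          + (y j - y i - ((j - i : ℝ) / N) • X (y i)) := by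
      push_cast
      module
    rw [h4]
    refine (norm_add₃_le).trans ?_
    calc _ ≤ δ / N + η / N + (η + δ) * ((j - i : ℝ) / N) := by gcongr
      _ = _ := by push_cast; ring

/-- The pointwise limit of approximate Euler orbits, read as step functions of time, along a
filter on which the step sizes and the errors tend to zero, is an integral curve. -/
theorem isIntegralCurveOn_of_tendsto_approx_euler {X : E → E} {M : ℝ}
    (hM : ∀ x, ‖X x‖ ≤ M) (hM0 : 0 ≤ M) (hX : UniformContinuous X)
    {ι : Type*} {l : Filter ι} [l.NeBot] {N : ι → ℕ} {δ : ι → ℝ} {y : ι → ℕ → E}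
    (hN : Tendsto N l atTop) (hδ : Tendsto δ l (𝓝 0)) (hδ0 : ∀ k, 0 ≤ δ k)
    (hδ1 : ∀ k, δ k ≤ 1)
    (hy : ∀ k, ∀ i < N k, ‖y k (i + 1) - y k i - (1 / N k : ℝ) • X (y k i)‖ ≤ δ k / N k)
    {z : ℝ → E}
    (hz : ∀ t ∈ Set.Icc (0 : ℝ) 1, Tendsto (fun k => y k ⌊t * N k⌋₊) l (𝓝 (z t))) :
    IsIntegralCurveOn z (fun _ => X) (Set.Icc 0 1) := by
  have hNR : Tendsto (fun k => (N k : ℝ)) l atTop := tendsto_natCast_atTop_atTop.comp hN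
  have hfl : ∀ t ∈ Set.Icc (0 : ℝ) 1, ∀ k, ⌊t * N k⌋₊ ≤ N k := fun t ht k =>
    Nat.floor_le_of_le (mul_le_of_le_one_left (by positivity) ht.2)
  have hdiff : ∀ s ∈ Set.Icc (0 : ℝ) 1, ∀ t ∈ Set.Icc (0 : ℝ) 1,
      Tendsto (fun k => ((⌊t * N k⌋₊ : ℝ) - ⌊s * N k⌋₊) / N k) l (𝓝 (t - s)) := by
    intro s hs t ht
    have := ((tendsto_nat_floor_mul_div_atTop ht.1).comp hNR).sub
      ((tendsto_nat_floor_mul_div_atTop hs.1).comp hNR)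
    exact this.congr fun k => by simp [sub_div]
  have hlip : ∀ s ∈ Set.Icc (0 : ℝ) 1, ∀ t ∈ Set.Icc (0 : ℝ) 1, s ≤ t →
      ‖z t - z s‖ ≤ (M + 1) * (t - s) := by
    intro s hs t ht hst
    refine le_of_tendsto_of_tendsto ((hz t ht).sub (hz s hs)).norm
      ((hdiff s hs t ht).const_mul (M + 1)) (Eventually.of_forall fun k => ?_)
    have hfloor : ⌊s * N k⌋₊ ≤ ⌊t * N k⌋₊ := Nat.floor_le_floor (by gcongr)
    refine (norm_sub_le_of_approx_euler hM (hy k) hfloor (hfl t ht k)).trans ?_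
    have h1 : (0 : ℝ) ≤ ((⌊t * N k⌋₊ : ℝ) - ⌊s * N k⌋₊) / N k :=
      div_nonneg (sub_nonneg.2 (by exact_mod_cast hfloor)) (by positivity)
    exact mul_le_mul_of_nonneg_right (by linarith [hδ1 k]) h1
  -- The first-order estimate passes to the limit for `s ≤ t`, with velocity taken at `s`.
  have hforward : ∀ η > 0, ∀ ρ, (∀ a b, ‖a - b‖ ≤ ρ → ‖X a - X b‖ ≤ η) →
      ∀ s ∈ Set.Icc (0 : ℝ) 1, ∀ t ∈ Set.Icc (0 : ℝ) 1, s ≤ t → (M + 1) * (t - s) < ρ →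
      ‖z t - z s - (t - s) • X (z s)‖ ≤ η * (t - s) := by
    intro η hη ρ hρ s hs t ht hst hlt
    have hXs : Tendsto (fun k => X (y k ⌊s * N k⌋₊)) l (𝓝 (X (z s))) :=
      (hX.continuous.tendsto _).comp (hz s hs)
    have hR : Tendsto (fun k => (η + δ k) * (((⌊t * N k⌋₊ : ℝ) - ⌊s * N k⌋₊) / N k)) l
        (𝓝 (η * (t - s))) := by
      simpa using (hδ.const_add η).mul (hdiff s hs t ht)
    refine le_of_tendsto_of_tendsto
      (((hz t ht).sub (hz s hs)).sub ((hdiff s hs t ht).smul hXs)).norm hR ?_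
    filter_upwards [((hdiff s hs t ht).const_mul (M + 1)).eventually_lt_const hlt] with k hk
    have hfloor : ⌊s * N k⌋₊ ≤ ⌊t * N k⌋₊ := Nat.floor_le_floor (by gcongr)
    have h1 : (0 : ℝ) ≤ ((⌊t * N k⌋₊ : ℝ) - ⌊s * N k⌋₊) / N k :=
      div_nonneg (sub_nonneg.2 (by exact_mod_cast hfloor)) (by positivity)
    refine norm_sub_sub_smul_le_of_approx_euler hM hM0 (hδ0 k) hρ (hy k) hfloor (hfl t ht k) ?_
    exact (mul_le_mul_of_nonneg_right (by linarith [hδ1 k]) h1).trans hk.le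
  intro s hs
  rw [hasDerivWithinAt_iff_isLittleO, Asymptotics.isLittleO_iff]
  intro c hc
  obtain ⟨ρ, hρ0, hρ⟩ := Metric.uniformContinuous_iff.1 hX (c / 2) (by positivity)
  have hρ' : ∀ a b, ‖a - b‖ ≤ ρ / 2 → ‖X a - X b‖ ≤ c / 2 := fun a b hab => by
    have := @hρ a b (by rw [dist_eq_norm]; linarith)
    rw [dist_eq_norm] at this
    exact this.le
  have hball : Metric.ball s (ρ / 2 / (M + 1)) ∈ 𝓝[Set.Icc 0 1] s :=
    mem_nhdsWithin_of_mem_nhds (Metric.ball_mem_nhds _ (by positivity))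
  filter_upwards [hball, self_mem_nhdsWithin] with t ht htI
  rw [Metric.mem_ball, Real.dist_eq, lt_div_iff₀ (by positivity), mul_comm] at ht
  rcases le_total s t with hst | hst
  · rw [abs_of_nonneg (by linarith)] at ht
    rw [Real.norm_of_nonneg (by linarith : 0 ≤ t - s)]
    refine (hforward _ (by positivity) _ hρ' s hs t htI hst ht).trans ?_
    nlinarith
  · rw [abs_of_nonpos (by linarith), neg_sub] at ht
    rw [Real.norm_of_nonpos (by linarith : t - s ≤ 0)]
    have h1 := hforward _ (by positivity) _ hρ' t htI s hs hst ht
    have h2 := hρ' (z t) (z s)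
      (by rw [norm_sub_rev]; exact (hlip t htI s hs hst).trans ht.le)
    have h3 : z t - z s - (t - s) • X (z s)
        = -(z s - z t - (s - t) • X (z t)) - (s - t) • (X (z t) - X (z s)) := by module
    rw [h3]
    refine (norm_sub_le _ _).trans ?_
    rw [norm_neg, norm_smul, Real.norm_of_nonneg (by linarith : 0 ≤ s - t)]
    nlinarith

/-- For a bounded uniformly continuous field, approximate Euler orbits starting near `x₀` follow
the unique integral curve from `x₀`. By contradiction: pointwise limits along an ultrafilter of a
sequence of ever better approximate orbits exist by local compactness and are integral curves. -/
theorem exists_approx_euler_close [ProperSpace E] {X : E → E} {M : ℝ}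
    (hM : ∀ x, ‖X x‖ ≤ M) (hX : UniformContinuous X) {x₀ : E} {γ : ℝ → E}
    (hγ : ContinuousOn γ (Set.Icc 0 1))
    (huniq : ∀ z : ℝ → E, z 0 = x₀ → IsIntegralCurveOn z (fun _ => X) (Set.Icc 0 1) →
      Set.EqOn z γ (Set.Icc 0 1)) {ε : ℝ} (hε : 0 < ε) :
    ∃ δ > 0, ∃ N₀ : ℕ, ∀ N ≥ N₀, ∀ y : ℕ → E, ‖y 0 - x₀‖ ≤ δ →
      (∀ i < N, ‖y (i + 1) - y i - (1 / N : ℝ) • X (y i)‖ ≤ δ / N) →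
      ∀ i ≤ N, ‖y i - γ (i / N)‖ < ε := by
  have hM0 : 0 ≤ M := (norm_nonneg _).trans (hM x₀)
  by_contra! hcon
  have hcon' : ∀ k : ℕ, ∃ N ≥ k + 1, ∃ y : ℕ → E, ‖y 0 - x₀‖ ≤ 1 / ((k : ℝ) + 1) ∧
      (∀ i < N, ‖y (i + 1) - y i - (1 / N : ℝ) • X (y i)‖ ≤ 1 / ((k : ℝ) + 1) / N) ∧
      ∃ i ≤ N, ε ≤ ‖y i - γ (i / N)‖ := fun k => hcon _ (by positivity) (k + 1)
  choose N hN y hy0 hy i hi hbad using hcon'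
  set U : Ultrafilter ℕ := hyperfilter ℕ
  have hU : (U : Filter ℕ) ≤ atTop := Nat.hyperfilter_le_atTop
  have hNtop : Tendsto N U atTop :=
    (tendsto_atTop_mono (fun k => (Nat.le_succ k).trans (hN k)) tendsto_id).mono_left hU
  have hNR : Tendsto (fun k => (N k : ℝ)) U atTop := tendsto_natCast_atTop_atTop.comp hNtop
  have hNpos : ∀ k, (0 : ℝ) < N k := fun k => by
    have := hN k
    exact_mod_cast (by omega : 0 < N k)
  have hδ : Tendsto (fun k : ℕ => 1 / ((k : ℝ) + 1)) U (𝓝 0) :=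
    tendsto_one_div_add_atTop_nhds_zero_nat.mono_left hU
  have hδ1 : ∀ k : ℕ, 1 / ((k : ℝ) + 1) ≤ 1 := fun k => by
    rw [div_le_one (by positivity)]
    linarith [(Nat.cast_nonneg k : (0 : ℝ) ≤ k)]
  have hfl : ∀ t ∈ Set.Icc (0 : ℝ) 1, ∀ k, ⌊t * N k⌋₊ ≤ N k := fun t ht k =>
    Nat.floor_le_of_le (mul_le_of_le_one_left (by positivity) ht.2)
  have hbdd : ∀ k, ∀ j ≤ N k, y k j ∈ Metric.closedBall x₀ (M + 2) := by
    intro k j hj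
    rw [mem_closedBall_iff_norm]
    have h1 := norm_sub_le_of_approx_euler hM (hy k) (Nat.zero_le j) hj
    have h2 : ((j : ℝ) - (0 : ℕ)) / N k ≤ 1 := by
      rw [div_le_one (hNpos k)]
      simpa using hj
    have h3 : (M + 1 / ((k : ℝ) + 1)) * (((j : ℝ) - (0 : ℕ)) / N k) ≤ (M + 1) * 1 := by
      have h4 : (0 : ℝ) ≤ ((j : ℝ) - (0 : ℕ)) / N k := by
        simp only [Nat.cast_zero, sub_zero]
        positivity
      exact mul_le_mul (by linarith [hδ1 k]) h2 h4 (by linarith)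
    have h5 := norm_sub_le_norm_sub_add_norm_sub (y k j) (y k 0) x₀
    linarith [hy0 k, hδ1 k]
  have hlim : ∀ t : ℝ, ∃ w : E, t ∈ Set.Icc (0 : ℝ) 1 →
      Tendsto (fun k => y k ⌊t * N k⌋₊) U (𝓝 w) := by
    intro t
    by_cases ht : t ∈ Set.Icc (0 : ℝ) 1
    · obtain ⟨w, -, hw⟩ := (isCompact_closedBall x₀ (M + 2)).ultrafilter_le_nhds'
        (U.map fun k => y k ⌊t * N k⌋₊)
        (Eventually.of_forall fun k => hbdd k _ (hfl t ht k) : ∀ᶠ k in (U : Filter ℕ), _)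
      exact ⟨w, fun _ => hw⟩
    · exact ⟨0, fun h => absurd h ht⟩
  choose z hz using hlim
  have hz0 : z 0 = x₀ := by
    refine tendsto_nhds_unique (hz 0 (by simp)) ?_
    simp only [zero_mul, Nat.floor_zero]
    rw [tendsto_iff_norm_sub_tendsto_zero]
    exact squeeze_zero (fun _ => norm_nonneg _) hy0 hδ
  have hcurve := isIntegralCurveOn_of_tendsto_approx_euler hM hM0 hX hNtop hδ
    (fun k => by positivity) hδ1 hy hz
  have heq := huniq z hz0 hcurve
  -- Along the ultrafilter the bad times converge to some `t`, where the orbits still converge to `γ t`.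
  obtain ⟨t, htI, ht⟩ := (isCompact_Icc (a := (0 : ℝ)) (b := 1)).ultrafilter_le_nhds'
    (U.map fun k => (i k / N k : ℝ))
    (Eventually.of_forall fun k => ⟨by positivity, by
      rw [div_le_one (hNpos k)]; exact_mod_cast hi k⟩ : ∀ᶠ k in (U : Filter ℕ), _)
  have ht : Tendsto (fun k => (i k / N k : ℝ)) U (𝓝 t) := ht
  have hγt : Tendsto (fun k => γ (i k / N k)) U (𝓝 (γ t)) := by
    refine Tendsto.comp (hγ t htI) (tendsto_nhdsWithin_iff.2 ⟨ht, Eventually.of_forall fun k => ?_⟩)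
    exact ⟨by positivity, by rw [div_le_one (hNpos k)]; exact_mod_cast hi k⟩
  have hgap : Tendsto (fun k => (M + 1) * |(i k / N k : ℝ) - (⌊t * N k⌋₊ : ℝ) / N k|) U (𝓝 0) := by
    have := (ht.sub ((tendsto_nat_floor_mul_div_atTop htI.1).comp hNR)).abs.const_mul (M + 1)
    simpa using this
  have hsub : Tendsto (fun k => y k (i k) - y k ⌊t * N k⌋₊) U (𝓝 0) := by
    rw [tendsto_zero_iff_norm_tendsto_zero]
    refine squeeze_zero (fun _ => norm_nonneg _) (fun k => ?_) hgap
    rw [← sub_div, abs_div, abs_of_pos (hNpos k)]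
    rcases le_total (i k) ⌊t * N k⌋₊ with hle | hle
    · rw [norm_sub_rev, abs_sub_comm, abs_of_nonneg (sub_nonneg.2 (by exact_mod_cast hle))]
      refine (norm_sub_le_of_approx_euler hM (hy k) hle (hfl t htI k)).trans ?_
      exact mul_le_mul_of_nonneg_right (by linarith [hδ1 k])
        (div_nonneg (sub_nonneg.2 (by exact_mod_cast hle)) (by positivity))
    · rw [abs_of_nonneg (sub_nonneg.2 (by exact_mod_cast hle))]
      refine (norm_sub_le_of_approx_euler hM (hy k) hle (hi k)).trans ?_
      exact mul_le_mul_of_nonneg_right (by linarith [hδ1 k])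
        (div_nonneg (sub_nonneg.2 (by exact_mod_cast hle)) (by positivity))
  have hyi : Tendsto (fun k => y k (i k) - γ (i k / N k)) U (𝓝 0) := by
    have := (hsub.add (hz t htI)).sub hγt
    rw [heq htI] at this
    simpa using this
  have := ge_of_tendsto hyi.norm (Eventually.of_forall hbad)
  simp at this
  linarith

end FlowApproximation

section FlowApproximationCompact

open Filter Topology

variable {E : Type*} [NormedAddCommGroup E] [NormedSpace ℝ E]

/-- Consistency and uniqueness give convergence: if the integral curve `γ` of `X` from `x₀` is
unique on every interval `[0, τ]`, then iterating any one-step map that is consistent with `X` on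
a large enough ball follows `γ`. The field is cut off outside the ball; uniqueness on the shorter
intervals shows, at the first exit time, that integral curves of the truncated field do not leave
the region where it agrees with `X`. -/
theorem exists_iterate_close [FiniteDimensional ℝ E] {X : E → E} (hX : Continuous X) {x₀ : E} {γ : ℝ → E}
    (hγ0 : γ 0 = x₀) (hγ : IsIntegralCurveOn γ (fun _ => X) (Set.Icc 0 1))
    (huniq : ∀ τ ∈ Set.Icc (0 : ℝ) 1, ∀ z : ℝ → E, z 0 = x₀ →
      IsIntegralCurveOn z (fun _ => X) (Set.Icc 0 τ) → Set.EqOn z γ (Set.Icc 0 τ))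
    {ε : ℝ} (hε : 0 < ε) :
    ∃ R : ℝ, ∃ δ > 0, ∃ N₀ : ℕ, ∀ N ≥ N₀, ∀ Ψ : E → E,
      (∀ x, ‖x‖ ≤ R → ‖Ψ x - x - (1 / N : ℝ) • X x‖ ≤ δ / N) →
      ∀ x, ‖x - x₀‖ ≤ δ → ‖Ψ^[N] x - γ 1‖ < ε := by
  have hγc : ContinuousOn γ (Set.Icc 0 1) := fun t ht => (hγ t ht).continuousWithinAt
  obtain ⟨C, hC⟩ := isCompact_Icc.exists_bound_of_continuousOn hγc
  have hC0 : 0 ≤ C := (norm_nonneg _).trans (hC 0 (by simp))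
  let χ : ContDiffBump (0 : E) := ⟨C + 1, C + 2, by linarith, by linarith⟩
  set Y : E → E := fun x => χ x • X x with hYdef
  have hYX : ∀ x, ‖x‖ ≤ C + 1 → Y x = X x := fun x hx => by
    rw [hYdef]
    simp only
    rw [χ.one_of_mem_closedBall (mem_closedBall_zero_iff.2 hx), one_smul]
  have hYc : Continuous Y := χ.continuous.smul hX
  have hYs : HasCompactSupport Y := χ.hasCompactSupport.smul_right
  obtain ⟨M, hM⟩ := hYs.exists_bound_of_continuous hYc
  have hYuniq : ∀ z : ℝ → E, z 0 = x₀ → IsIntegralCurveOn z (fun _ => Y) (Set.Icc 0 1) →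
      Set.EqOn z γ (Set.Icc 0 1) := by
    intro z hz0 hz
    have hzc : ContinuousOn z (Set.Icc 0 1) := fun t ht => (hz t ht).continuousWithinAt
    have hkey : ∀ τ ∈ Set.Icc (0 : ℝ) 1, (∀ t ∈ Set.Icc 0 τ, ‖z t‖ ≤ C + 1) →
        Set.EqOn z γ (Set.Icc 0 τ) := by
      intro τ hτ hle
      refine huniq τ hτ z hz0 fun t ht => ?_
      have : HasDerivWithinAt z (Y (z t)) (Set.Icc 0 τ) t :=
        (hz t ⟨ht.1, ht.2.trans hτ.2⟩).mono (Set.Icc_subset_Icc_right hτ.2)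
      rwa [hYX _ (hle t ht)] at this
    refine hkey 1 (by simp) ?_
    by_contra! hex
    obtain ⟨t₀, ht₀, hbig⟩ := hex
    -- The first time at which `z` reaches the sphere of radius `C + 1`.
    set S : Set ℝ := Set.Icc 0 1 ∩ (fun t => ‖z t‖) ⁻¹' Set.Ici (C + 1)
    have hScl : IsClosed S := hzc.norm.preimage_isClosed_of_isClosed isClosed_Icc isClosed_Ici
    have hScp : IsCompact S := isCompact_Icc.of_isClosed_subset hScl Set.inter_subset_left
    obtain ⟨τ, ⟨hτI, hτbig⟩, hτmin⟩ := hScp.exists_isLeast ⟨t₀, ht₀, hbig.le⟩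
    have hτbig : C + 1 ≤ ‖z τ‖ := hτbig
    have hτpos : 0 < τ := by
      rcases hτI.1.eq_or_lt with h0 | h0
      · rw [← h0, hz0, ← hγ0] at hτbig
        linarith [hC 0 (by simp)]
      · exact h0
    have hlt : ∀ t ∈ Set.Ico 0 τ, ‖z t‖ ≤ C + 1 := by
      intro t ht
      by_contra! hgt
      exact absurd (hτmin ⟨⟨ht.1, ht.2.le.trans hτI.2⟩, hgt.le⟩) (not_le.2 ht.2)
    have hle : ∀ t ∈ Set.Icc 0 τ, ‖z t‖ ≤ C + 1 := by
      have hcl : Set.Icc 0 τ ⊆ closure (Set.Ico 0 τ) := by rw [closure_Ico hτpos.ne]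
      intro t ht
      have hct : ContinuousWithinAt (fun t => ‖z t‖) (Set.Ico 0 τ) t :=
        (hzc.norm t ⟨ht.1, ht.2.trans hτI.2⟩).mono
          (fun s hs => ⟨hs.1, hs.2.le.trans hτI.2⟩)
      have := hct.mem_closure (hcl ht) (t := Set.Iic (C + 1)) (fun s hs => hlt s hs)
      rwa [isClosed_Iic.closure_eq] at this
    have := hkey τ hτI hle (Set.right_mem_Icc.2 hτpos.le)
    rw [this] at hτbig
    linarith [hC τ hτI]
  obtain ⟨δ, hδ, N₀, hN₀⟩ := exists_approx_euler_close hM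
    (hYs.uniformContinuous_of_continuous hYc) hγc hYuniq (lt_min hε one_pos)
  refine ⟨C + 1, δ, hδ, max N₀ 1, fun N hN Ψ hΨ x hx => ?_⟩
  have hN1 : (N : ℝ) ≠ 0 := by
    have := le_of_max_le_right hN
    exact_mod_cast (by omega : N ≠ 0)
  -- The orbit of `Ψ`, continued by exact Euler steps of `Y` once it leaves the ball.
  classical
  set G : E → E := fun x => if ‖x‖ ≤ C + 1 then Ψ x else x + (1 / N : ℝ) • Y x
  have hG := hN₀ N (le_of_max_le_left hN) (fun i => G^[i] x) hx (fun i _ => by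
    rw [Function.iterate_succ_apply']
    by_cases hi : ‖G^[i] x‖ ≤ C + 1
    · simp only [G, if_pos hi]
      rw [hYX _ hi]
      exact hΨ _ hi
    · simp only [G, if_neg hi]
      rw [add_sub_cancel_left, sub_self, norm_zero]
      positivity)
  have hball : ∀ i ≤ N, ‖G^[i] x‖ ≤ C + 1 := by
    intro i hi
    have h1 := (hG i hi).trans_le (min_le_right _ _)
    have h2 : ‖γ (i / N)‖ ≤ C := hC _ ⟨by positivity, div_le_one_of_le₀ (by exact_mod_cast hi)
      (by positivity)⟩
    have h3 := norm_sub_norm_le (G^[i] x) (γ (i / N))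
    linarith
  have hiter : ∀ i ≤ N, G^[i] x = Ψ^[i] x := by
    intro i
    induction i with
    | zero => simp
    | succ i ih =>
      intro hi
      rw [Function.iterate_succ_apply', Function.iterate_succ_apply', ← ih (by omega)]
      simp only [G, if_pos (hball i (by omega))]
  have := (hG N le_rfl).trans_le (min_le_left _ _)
  rwa [hiter N le_rfl, div_self hN1] at this

/-- Uniform version of `exists_iterate_close` on a compact set of initial points. Comparing the
time-one map at nearby points with one and the same sequence of Euler orbits shows that it is
continuous. -/
theorem exists_iterate_close_of_isCompact [FiniteDimensional ℝ E] {X : E → E} (hX : Continuous X) {Ω : Set E}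
    (hΩ : IsCompact Ω) {φ : E → E}
    (hφ : ∀ x ∈ Ω, ∃ γ : ℝ → E, γ 0 = x ∧ γ 1 = φ x ∧
      IsIntegralCurveOn γ (fun _ => X) (Set.Icc 0 1) ∧
      ∀ τ ∈ Set.Icc (0 : ℝ) 1, ∀ z : ℝ → E, z 0 = x →
        IsIntegralCurveOn z (fun _ => X) (Set.Icc 0 τ) → Set.EqOn z γ (Set.Icc 0 τ))
    {ε : ℝ} (hε : 0 < ε) :
    ∃ R : ℝ, ∃ δ > 0, ∃ N₀ : ℕ, ∀ N ≥ N₀, ∀ Ψ : E → E,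
      (∀ x, ‖x‖ ≤ R → ‖Ψ x - x - (1 / N : ℝ) • X x‖ ≤ δ / N) →
      ∀ x ∈ Ω, ‖Ψ^[N] x - φ x‖ < ε := by
  have hloc : ∀ x₀ ∈ Ω, ∀ ε > 0, ∃ R : ℝ, ∃ δ > 0, ∃ N₀ : ℕ, ∀ N ≥ N₀, ∀ Ψ : E → E,
      (∀ x, ‖x‖ ≤ R → ‖Ψ x - x - (1 / N : ℝ) • X x‖ ≤ δ / N) →
      ∀ x, ‖x - x₀‖ ≤ δ → ‖Ψ^[N] x - φ x₀‖ < ε := by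
    intro x₀ hx₀ ε hε
    obtain ⟨γ, h0, h1, hc, hu⟩ := hφ x₀ hx₀
    rw [← h1]
    exact exists_iterate_close hX h0 hc hu hε
  refine hΩ.induction_on (p := fun S => ∃ R : ℝ, ∃ δ > 0, ∃ N₀ : ℕ, ∀ N ≥ N₀, ∀ Ψ : E → E,
      (∀ x, ‖x‖ ≤ R → ‖Ψ x - x - (1 / N : ℝ) • X x‖ ≤ δ / N) →
      ∀ x ∈ S, ‖Ψ^[N] x - φ x‖ < ε) ?_ ?_ ?_ ?_
  · exact ⟨0, 1, one_pos, 0, by simp⟩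
  · rintro S T hST ⟨R, δ, hδ, N₀, hT⟩
    exact ⟨R, δ, hδ, N₀, fun N hN Ψ hΨ x hx => hT N hN Ψ hΨ x (hST hx)⟩
  · rintro S T ⟨R, δ, hδ, N₀, hS⟩ ⟨R', δ', hδ', N₀', hT⟩
    refine ⟨max R R', min δ δ', lt_min hδ hδ', max N₀ N₀', fun N hN Ψ hΨ x hx => ?_⟩
    rcases hx with hx | hx
    · refine hS N (le_of_max_le_left hN) Ψ (fun x hx => ?_) x hx
      refine (hΨ x (hx.trans (le_max_left _ _))).trans ?_
      gcongr
      exact min_le_left _ _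
    · refine hT N (le_of_max_le_right hN) Ψ (fun x hx => ?_) x hx
      refine (hΨ x (hx.trans (le_max_right _ _))).trans ?_
      gcongr
      exact min_le_right _ _
  · intro x₀ hx₀
    obtain ⟨R, δ, hδ, N₀, h₀⟩ := hloc x₀ hx₀ (ε / 4) (by positivity)
    refine ⟨Metric.closedBall x₀ δ ∩ Ω, ?_, R, δ, hδ, N₀, fun N hN Ψ hΨ x hx => ?_⟩
    · rw [Set.inter_comm]
      exact Filter.inter_mem self_mem_nhdsWithin
        (mem_nhdsWithin_of_mem_nhds (Metric.closedBall_mem_nhds x₀ hδ))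
    have hxδ : ‖x - x₀‖ ≤ δ := mem_closedBall_iff_norm.1 hx.1
    have h1 := h₀ N hN Ψ hΨ x hxδ
    obtain ⟨R', δ', hδ', N₀', h₀'⟩ := hloc x hx.2 (ε / 4) (by positivity)
    set n := max N₀ N₀'
    set Θ : E → E := fun x => x + (1 / n : ℝ) • X x
    have hΘ : ∀ d > 0, ∀ x, ‖Θ x - x - (1 / n : ℝ) • X x‖ ≤ d / n := by
      intro d hd x
      simp only [Θ]
      rw [add_sub_cancel_left, sub_self, norm_zero]
      positivity
    have h2 := h₀ n (le_max_left _ _) Θ (fun x _ => hΘ δ hδ x) x hxδ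
    have h3 := h₀' n (le_max_right _ _) Θ (fun x _ => hΘ δ' hδ' x) x (by simpa using hδ'.le)
    have h4 : Ψ^[N] x - φ x
        = (Ψ^[N] x - φ x₀) - (Θ^[n] x - φ x₀) + (Θ^[n] x - φ x) := by abel
    rw [h4]
    have h5 := norm_add_le ((Ψ^[N] x - φ x₀) - (Θ^[n] x - φ x₀)) (Θ^[n] x - φ x)
    have h6 := norm_sub_le (Ψ^[N] x - φ x₀) (Θ^[n] x - φ x₀)
    linarith

/-! ### One-step maps consistent with a vector field -/

/-- The family `f τ` of maps is consistent with the vector field `X`: `f τ x = x + τ X(x) + o(τ)`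
as `τ → 0`, for both signs of `τ` and uniformly on bounded sets of `x`. -/
def IsConsistent (f : ℝ → E → E) (X : E → E) : Prop :=
  ∀ R : ℝ, ∀ δ > 0, ∃ τ₀ > 0, ∀ τ : ℝ, |τ| ≤ τ₀ → ∀ x, ‖x‖ ≤ R →
    ‖f τ x - x - τ • X x‖ ≤ δ * |τ|

theorem isConsistent_add_smul (X : E → E) : IsConsistent (fun τ x => x + τ • X x) X := by
  intro R δ hδ
  refine ⟨1, one_pos, fun τ _ x _ => ?_⟩
  rw [add_sub_cancel_left, sub_self, norm_zero]
  positivity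

theorem IsConsistent.const_smul {f : ℝ → E → E} {X : E → E} (hf : IsConsistent f X) (c : ℝ) :
    IsConsistent (fun τ => f (c * τ)) (c • X) := by
  intro R δ hδ
  obtain ⟨τ₀, hτ₀, h⟩ := hf R (δ / (|c| + 1)) (by positivity)
  refine ⟨τ₀ / (|c| + 1), by positivity, fun τ hτ x hx => ?_⟩
  rw [le_div_iff₀ (by positivity)] at hτ
  have h1 := h (c * τ) (by rw [abs_mul]; nlinarith [abs_nonneg τ]) x hx
  rw [Pi.smul_apply, smul_smul, mul_comm τ c]
  refine h1.trans ?_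
  rw [abs_mul, div_mul_eq_mul_div, div_le_iff₀ (by positivity)]
  nlinarith [mul_nonneg hδ.le (abs_nonneg τ)]

/-- The Lie–Trotter splitting: one-step maps of two fields compose to a one-step map of their
sum. -/
theorem IsConsistent.comp [FiniteDimensional ℝ E] {f g : ℝ → E → E} {X Y : E → E} (hf : IsConsistent f X)
    (hg : IsConsistent g Y) (hX : Continuous X) (hY : Continuous Y) :
    IsConsistent (fun τ => g τ ∘ f τ) (X + Y) := by
  intro R δ hδ
  have hcomp := isCompact_closedBall (0 : E) (R + 1)
  obtain ⟨M, hM⟩ := hcomp.exists_bound_of_continuousOn hX.continuousOn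
  obtain ⟨ρ, hρ, hYρ⟩ := Metric.uniformContinuousOn_iff.1
    (hcomp.uniformContinuousOn_of_continuous hY.continuousOn) (δ / 3) (by positivity)
  obtain ⟨τ₁, hτ₁, h₁⟩ := hf R (min (δ / 3) 1) (by positivity)
  obtain ⟨τ₂, hτ₂, h₂⟩ := hg (R + 1) (δ / 3) (by positivity)
  set B := |M| + 1
  have hB : 0 < B := by positivity
  refine ⟨min (min τ₁ τ₂) (min (1 / B) (ρ / 2 / B)), by positivity, fun τ hτ x hx => ?_⟩
  simp only [le_min_iff, le_div_iff₀ hB] at hτ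
  obtain ⟨⟨hτ1, hτ2⟩, hτ3, hτ4⟩ := hτ
  have e1 := h₁ τ hτ1 x hx
  have hMx : ‖X x‖ ≤ |M| := (hM x (by simpa using by linarith)).trans (le_abs_self M)
  have e2 : ‖f τ x - x‖ ≤ |τ| * B := by
    have h3 : f τ x - x = (f τ x - x - τ • X x) + τ • X x := by abel
    rw [h3]
    refine (norm_add_le _ _).trans ?_
    rw [norm_smul, Real.norm_eq_abs]
    have := e1.trans (mul_le_mul_of_nonneg_right (min_le_right _ _) (abs_nonneg τ))
    have := mul_le_mul_of_nonneg_left hMx (abs_nonneg τ)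
    simp only [B]
    linarith
  have e3 : ‖f τ x‖ ≤ R + 1 := by
    have := norm_sub_norm_le (f τ x) x
    linarith
  have e4 := h₂ τ hτ2 _ e3
  have e5 : ‖τ • (Y (f τ x) - Y x)‖ ≤ |τ| * (δ / 3) := by
    rw [norm_smul, Real.norm_eq_abs]
    have := hYρ (f τ x) (by simpa using e3) x (by simpa using by linarith)
      (by rw [dist_eq_norm]; linarith)
    rw [dist_eq_norm] at this
    gcongr
  have e6 : (g τ ∘ f τ) x - x - τ • (X + Y) x = (g τ (f τ x) - f τ x - τ • Y (f τ x))
      + (f τ x - x - τ • X x) + τ • (Y (f τ x) - Y x) := by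
    simp only [Function.comp_apply, Pi.add_apply]
    module
  rw [e6]
  refine norm_add₃_le.trans ?_
  have := e1.trans (mul_le_mul_of_nonneg_right (min_le_left _ _) (abs_nonneg τ))
  linarith

end FlowApproximationCompact

/-! ### Density of dilated translates of a non-polynomial function of one variable -/

section OneVariable

open Filter Topology MeasureTheory Polynomial

theorem exists_polynomial_of_iteratedDeriv_eq_zero {f : ℝ → ℝ} {k : ℕ} (hf : ContDiff ℝ k f)
    (h : ∀ x, iteratedDeriv k f x = 0) : ∃ P : ℝ[X], P.degree < k ∧ ∀ x, f x = P.eval x := by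
  rcases k with _ | n
  · refine ⟨0, by simp, fun x => ?_⟩
    simpa using h x
  · refine ⟨∑ i : Fin (n + 1), C ((((i : ℕ).factorial : ℝ)⁻¹) * iteratedDeriv i f 0) * X ^ (i : ℕ),
      degree_sum_fin_lt _, fun x => ?_⟩
    rw [eval_finsetSum]
    simp only [eval_mul, eval_C, eval_pow, eval_X]
    rw [Fin.sum_univ_eq_sum_range
      (fun i => (((i.factorial : ℝ)⁻¹) * iteratedDeriv i f 0) * x ^ i) (n + 1)]
    rcases eq_or_ne 0 x with rfl | hx
    · rw [Finset.sum_range_succ']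
      simp
    · obtain ⟨x', -, hx'⟩ := taylor_mean_remainder_lagrange_iteratedDeriv (n := n) hx
        (by exact_mod_cast hf.contDiffOn)
      rw [h, zero_mul, zero_div, sub_eq_zero, taylor_within_apply] at hx'
      rw [hx']
      refine Finset.sum_congr rfl fun i hi => ?_
      rw [iteratedDerivWithin_eq_iteratedDeriv (uniqueDiffOn_uIcc hx) _ Set.left_mem_uIcc]
      · simp only [sub_zero, smul_eq_mul]
        ring
      · refine (hf.of_le ?_).contDiffAt
        exact_mod_cast (Finset.mem_range.1 hi).le

/-- Polynomials of degree less than `k` are determined by their values at `0, …, k - 1` through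
Lagrange interpolation, hence they are closed under pointwise limits. -/
theorem exists_polynomial_of_tendsto {ι : Type*} {l : Filter ι} [l.NeBot] {k : ℕ}
    {P : ι → ℝ[X]} (hP : ∀ i, (P i).degree < k) {f : ℝ → ℝ}
    (hf : ∀ x, Tendsto (fun i => (P i).eval x) l (𝓝 (f x))) :
    ∃ Q : ℝ[X], Q.degree < k ∧ ∀ x, f x = Q.eval x := by
  have hinj : Set.InjOn (fun j : ℕ => (j : ℝ)) (Finset.range k) := Nat.cast_injective.injOn
  refine ⟨Lagrange.interpolate (Finset.range k) (fun j : ℕ => (j : ℝ)) (fun j => f j), ?_,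
    fun x => ?_⟩
  · simpa using Lagrange.degree_interpolate_lt (fun j : ℕ => f j) hinj
  · refine tendsto_nhds_unique (hf x) ?_
    have heq : ∀ i, (P i).eval x = ∑ j ∈ Finset.range k, (P i).eval (j : ℝ)
        * (Lagrange.basis (Finset.range k) (fun j : ℕ => (j : ℝ)) j).eval x := by
      intro i
      conv_lhs => rw [Lagrange.eq_interpolate (f := P i) hinj (by simpa using hP i)]
      simp [Lagrange.interpolate_apply, eval_finsetSum]
    simp only [heq]
    rw [Lagrange.interpolate_apply, eval_finsetSum]
    simp only [eval_mul, eval_C]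
    exact tendsto_finsetSum _ fun j _ => (hf j).mul_const _

/-- The smooth average `(φ ⋆ g)(x) = ∫ φ(t) g(x - t) dt` of `g` against a normalized bump. -/
noncomputable def mollify (φ : ContDiffBump (0 : ℝ)) (g : ℝ → ℝ) : ℝ → ℝ :=
  convolution (φ.normed volume) g (ContinuousLinearMap.lsmul ℝ ℝ) volume

theorem mollify_apply (φ : ContDiffBump (0 : ℝ)) (g : ℝ → ℝ) (x : ℝ) :
    mollify φ g x = ∫ t, φ.normed volume t * g (x - t) := rfl

theorem contDiff_mollify (φ : ContDiffBump (0 : ℝ)) {g : ℝ → ℝ} (hg : Continuous g) (k : ℕ) :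
    ContDiff ℝ k (mollify φ g) := by
  have := (φ.hasCompactSupport_normed (μ := volume)).contDiff_convolution_left (n := k) (μ := volume)
    (ContinuousLinearMap.lsmul ℝ ℝ) φ.contDiff_normed hg.locallyIntegrable
  exact_mod_cast this

/-- If no mollification of `g` had a non-zero `k`-th derivative, all of them would be polynomials
of degree less than `k`, and so would their limit `g`. -/
theorem exists_iteratedDeriv_mollify_ne_zero {g : ℝ → ℝ} (hg : Continuous g)
    (hpoly : ¬ ∃ P : ℝ[X], ∀ x, g x = P.eval x) (k : ℕ) :
    ∃ (φ : ContDiffBump (0 : ℝ)) (b : ℝ), iteratedDeriv k (mollify φ g) b ≠ 0 := by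
  by_contra! hcon
  let φ : ℕ → ContDiffBump (0 : ℝ) := fun i =>
    ⟨1 / ((i : ℝ) + 1) / 2, 1 / ((i : ℝ) + 1), by positivity, half_lt_self (by positivity)⟩
  have hφ : Tendsto (fun i => (φ i).rOut) atTop (𝓝 0) := tendsto_one_div_add_atTop_nhds_zero_nat
  choose P hP hPeq using fun i =>
    exists_polynomial_of_iteratedDeriv_eq_zero (contDiff_mollify (φ i) hg k) (hcon (φ i))
  obtain ⟨Q, -, hQ⟩ := exists_polynomial_of_tendsto (l := atTop) hP (f := g) fun x => by
    simp only [← hPeq]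
    exact ContDiffBump.convolution_tendsto_right_of_continuous hφ hg x
  exact hpoly ⟨Q, hQ⟩

/-- The function `y ↦ g (c y + b)` on the interval `[-r, r]`. -/
def dilate (r : ℝ) (g : C(ℝ, ℝ)) (c b : ℝ) : C(Set.Icc (-r) r, ℝ) :=
  ⟨fun y => g (c * y + b), by fun_prop⟩

/-- The closed linear span of the functions `y ↦ g (c y + b)`, `c ≠ 0`, on `[-r, r]`. -/
noncomputable def dilateSpan (r : ℝ) (g : C(ℝ, ℝ)) : Submodule ℝ C(Set.Icc (-r) r, ℝ) :=
  (Submodule.span ℝ (Set.range fun q : ℝˣ × ℝ => dilate r g q.1 q.2)).topologicalClosure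

theorem isClosed_dilateSpan (r : ℝ) (g : C(ℝ, ℝ)) :
    IsClosed (dilateSpan r g : Set C(Set.Icc (-r) r, ℝ)) :=
  Submodule.isClosed_topologicalClosure _

theorem dilate_mem_dilateSpan (r : ℝ) (g : C(ℝ, ℝ)) {c : ℝ} (hc : c ≠ 0) (b : ℝ) :
    dilate r g c b ∈ dilateSpan r g :=
  Submodule.le_topologicalClosure _ (Submodule.subset_span ⟨(Units.mk0 c hc, b), rfl⟩)

theorem integral_mem_of_isClosed {F : Type*} [NormedAddCommGroup F] [NormedSpace ℝ F]
    [CompleteSpace F] {M : Submodule ℝ F} (hM : IsClosed (M : Set F)) {f : ℝ → F}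
    (hf : Continuous f) (hfs : HasCompactSupport f) (hmem : ∀ t, f t ∈ M) : ∫ t, f t ∈ M := by
  have : CompleteSpace M := hM.completeSpace_coe
  have hs : HasCompactSupport fun t => (⟨f t, hmem t⟩ : M) := by
    refine hfs.mono fun t ht => ?_
    simpa [Subtype.ext_iff] using ht
  have h1 := M.subtypeL.integral_comp_comm
    ((hf.subtype_mk hmem).integrable_of_hasCompactSupport (μ := volume) hs)
  simp only [Submodule.subtypeL_apply] at h1
  rw [h1]
  exact Submodule.coe_mem _

/-- Dilated translates of mollifications of `g` are integrals of dilated translates of `g`. -/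
theorem dilate_mollify_mem_dilateSpan (r : ℝ) (g ψ : C(ℝ, ℝ)) (φ : ContDiffBump (0 : ℝ))
    (hψ : ∀ x, ψ x = mollify φ g x) {c : ℝ} (hc : c ≠ 0) (b : ℝ) :
    dilate r ψ c b ∈ dilateSpan r g := by
  have hdc : Continuous fun t => dilate r g c (b - t) := by
    refine ContinuousMap.continuous_of_continuous_uncurry _ ?_
    simp only [dilate, Function.uncurry_def, ContinuousMap.coe_mk]
    fun_prop
  have hFc : Continuous fun t => φ.normed volume t • dilate r g c (b - t) :=
    φ.continuous_normed.smul hdc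
  have hFs : HasCompactSupport fun t => φ.normed volume t • dilate r g c (b - t) :=
    φ.hasCompactSupport_normed.smul_right
  have hint : dilate r ψ c b = ∫ t, φ.normed volume t • dilate r g c (b - t) := by
    ext y
    rw [ContinuousMap.integral_apply (hFc.integrable_of_hasCompactSupport hFs)]
    simp only [dilate, ContinuousMap.coe_mk, hψ, mollify_apply, ContinuousMap.smul_apply,
      smul_eq_mul, add_sub_assoc]
  rw [hint]
  exact integral_mem_of_isClosed (isClosed_dilateSpan r g) hFc hFs fun t =>
    Submodule.smul_mem _ _ (dilate_mem_dilateSpan r g hc _)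

/-- The monomial `y ^ k` on `[-r, r]`. -/
def monomialOn (r : ℝ) (k : ℕ) : C(Set.Icc (-r) r, ℝ) := ⟨fun y => (y : ℝ) ^ k, by fun_prop⟩

/-- All monomials lie in the closed span of the dilated translates of `g`, by strong induction:
for a mollification `ψ` whose `k`-th derivative at `b` does not vanish, Taylor's formula at `b`
exhibits `ψ⁽ᵏ⁾(b) yᵏ / k!` as the limit for `c → 0` of `c⁻ᵏ` times the difference of `ψ (c y + b)`
and a polynomial in `y` of degree less than `k`. -/
theorem monomialOn_mem_dilateSpan (r : ℝ) (g : C(ℝ, ℝ))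
    (hpoly : ¬ ∃ P : ℝ[X], ∀ x, g x = P.eval x) (k : ℕ) :
    monomialOn r k ∈ dilateSpan r g := by
  induction k using Nat.strong_induction_on with
  | _ k ih =>
  obtain ⟨φ, b, hb⟩ := exists_iteratedDeriv_mollify_ne_zero g.continuous hpoly k
  have hsm := contDiff_mollify φ g.continuous k
  let ψ : C(ℝ, ℝ) := ⟨mollify φ g, hsm.continuous⟩
  set a : ℕ → ℝ := fun j => ((j.factorial : ℝ)⁻¹) * iteratedDeriv j ψ b with ha
  have hak : a k ≠ 0 := mul_ne_zero (by positivity) hb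
  suffices h : a k • monomialOn r k ∈ dilateSpan r g by
    have := (dilateSpan r g).smul_mem (a k)⁻¹ h
    rwa [smul_smul, inv_mul_cancel₀ hak, one_smul] at this
  set q : ℝ → C(Set.Icc (-r) r, ℝ) := fun c =>
    (c ^ k)⁻¹ • (dilate r ψ c b - ∑ j ∈ Finset.range k, (a j * c ^ j) • monomialOn r j)
  have hq : ∀ᶠ c in 𝓝[≠] (0 : ℝ), q c ∈ dilateSpan r g := by
    filter_upwards [self_mem_nhdsWithin] with c hc
    refine Submodule.smul_mem _ _ (Submodule.sub_mem _
      (dilate_mollify_mem_dilateSpan r g ψ φ (fun _ => rfl) hc b) ?_)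
    exact Submodule.sum_mem _ fun j hj => Submodule.smul_mem _ _ (ih j (Finset.mem_range.1 hj))
  refine (isClosed_dilateSpan r g).mem_of_tendsto ?_ hq
  have htaylor := taylor_isLittleO_univ (x₀ := b) (n := k) (f := ψ) hsm
  rw [Metric.tendsto_nhds]
  intro ε hε
  rw [Asymptotics.isLittleO_iff] at htaylor
  obtain ⟨ρ, hρ, hball⟩ := Metric.eventually_nhds_iff.1
    (htaylor (c := ε / 2 / (|r| + 1) ^ k) (by positivity))
  have hsmall : Metric.ball (0 : ℝ) (ρ / (|r| + 1)) ∈ 𝓝[≠] (0 : ℝ) :=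
    mem_nhdsWithin_of_mem_nhds (Metric.ball_mem_nhds _ (by positivity))
  filter_upwards [hsmall, self_mem_nhdsWithin] with c hcball hc
  have hc : c ≠ 0 := hc
  rw [mem_ball_zero_iff, Real.norm_eq_abs, lt_div_iff₀ (by positivity)] at hcball
  rw [dist_eq_norm]
  refine lt_of_le_of_lt ?_ (half_lt_self hε)
  rw [ContinuousMap.norm_le _ (by positivity)]
  rintro ⟨y, hy⟩
  have hy' : |y| ≤ |r| + 1 := by
    rw [abs_le]
    constructor <;> linarith [hy.1, hy.2, le_abs_self r]
  have h1 := @hball (c * y + b) (by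
    rw [Real.dist_eq, add_sub_cancel_right, abs_mul]
    exact lt_of_le_of_lt (by gcongr) hcball)
  rw [taylor_within_apply, Finset.sum_range_succ, iteratedDerivWithin_univ] at h1
  simp only [add_sub_cancel_right, smul_eq_mul, iteratedDerivWithin_univ] at h1
  have h2 : (q c - a k • monomialOn r k) ⟨y, hy⟩ = (c ^ k)⁻¹ * (ψ (c * y + b)
      - (∑ j ∈ Finset.range k, ((j.factorial : ℝ)⁻¹ * (c * y) ^ j) * iteratedDeriv j ψ b
        + ((k.factorial : ℝ)⁻¹ * (c * y) ^ k) * iteratedDeriv k ψ b)) := by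
    have hck : c ^ k ≠ 0 := pow_ne_zero _ hc
    have h3 : ∑ j ∈ Finset.range k, ((j.factorial : ℝ)⁻¹ * (c * y) ^ j) * iteratedDeriv j ψ b
        = ∑ j ∈ Finset.range k, (a j * c ^ j) * y ^ j :=
      Finset.sum_congr rfl fun j _ => by rw [ha, mul_pow]; ring
    rw [h3]
    simp only [q, dilate, monomialOn, ha, ContinuousMap.sub_apply, ContinuousMap.smul_apply,
      ContinuousMap.coe_mk, ContinuousMap.sum_apply, smul_eq_mul]
    field_simp
    ring
  rw [h2, norm_mul, norm_inv, norm_pow]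
  have hcpos : 0 < ‖c‖ ^ k := pow_pos (norm_pos_iff.2 hc) k
  rw [inv_mul_le_iff₀ hcpos]
  refine h1.trans ?_
  rw [mul_pow, norm_mul, norm_pow, norm_pow, mul_comm, mul_assoc]
  refine mul_le_mul_of_nonneg_left ?_ hcpos.le
  rw [← mul_div_assoc, div_le_iff₀ (by positivity), mul_comm]
  exact mul_le_mul_of_nonneg_left (pow_le_pow_left₀ (norm_nonneg _) hy' k) (by positivity)

theorem dilateSpan_eq_top (r : ℝ) (g : C(ℝ, ℝ))
    (hpoly : ¬ ∃ P : ℝ[X], ∀ x, g x = P.eval x) : dilateSpan r g = ⊤ := by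
  have hmem : ∀ P : ℝ[X], P.toContinuousMapOn (Set.Icc (-r) r) ∈ dilateSpan r g := by
    intro P
    induction P using Polynomial.induction_on' with
    | add p q hp hq =>
      have : (p + q).toContinuousMapOn (Set.Icc (-r) r)
          = p.toContinuousMapOn (Set.Icc (-r) r) + q.toContinuousMapOn (Set.Icc (-r) r) := by
        ext; simp
      rw [this]
      exact Submodule.add_mem _ hp hq
    | monomial k a =>
      have : (monomial k a).toContinuousMapOn (Set.Icc (-r) r) = a • monomialOn r k := by
        ext; simp [monomialOn]
      rw [this]
      exact Submodule.smul_mem _ _ (monomialOn_mem_dilateSpan r g hpoly k)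
  rw [eq_top_iff]
  intro f _
  have hf : f ∈ (polynomialFunctions (Set.Icc (-r) r)).topologicalClosure := by
    rw [polynomialFunctions.topologicalClosure]
    trivial
  refine closure_minimal ?_ (isClosed_dilateSpan r g) hf
  intro p hp
  obtain ⟨P, -, rfl⟩ := hp
  exact hmem P

/-- Every continuous function of one variable is approximated, uniformly on bounded intervals, by
linear combinations of dilated translates of a non-polynomial continuous function. -/
theorem exists_dilate_combination_close {g : ℝ → ℝ} (hg : Continuous g)
    (hpoly : ¬ ∃ P : ℝ[X], ∀ x, g x = P.eval x) {f : ℝ → ℝ} (hf : Continuous f) (r : ℝ)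
    {ε : ℝ} (hε : 0 < ε) :
    ∃ p ∈ Submodule.span ℝ (Set.range fun (q : ℝˣ × ℝ) (y : ℝ) => g (q.1 * y + q.2)),
      ∀ y, |y| ≤ r → |p y - f y| < ε := by
  have htop : (⟨fun y => f y, by fun_prop⟩ : C(Set.Icc (-r) r, ℝ)) ∈ dilateSpan r ⟨g, hg⟩ := by
    rw [dilateSpan_eq_top r ⟨g, hg⟩ hpoly]
    trivial
  obtain ⟨s, hs, hsf⟩ := Metric.mem_closure_iff.1 htop ε hε
  have hext : ∃ p ∈ Submodule.span ℝ (Set.range fun (q : ℝˣ × ℝ) (y : ℝ) => g (q.1 * y + q.2)),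
      ∀ y : Set.Icc (-r) r, p y = s y := by
    refine Submodule.span_induction (p := fun s _ => ∃ p ∈ Submodule.span ℝ
      (Set.range fun (q : ℝˣ × ℝ) (y : ℝ) => g (q.1 * y + q.2)),
      ∀ y : Set.Icc (-r) r, p y = s y) ?_ ?_ ?_ ?_ hs
    · rintro _ ⟨q, rfl⟩
      exact ⟨_, Submodule.subset_span ⟨q, rfl⟩, fun y => rfl⟩
    · exact ⟨0, Submodule.zero_mem _, fun y => rfl⟩
    · rintro s t - - ⟨p, hp, hps⟩ ⟨q, hq, hqt⟩
      exact ⟨p + q, Submodule.add_mem _ hp hq, fun y => by simp [hps, hqt]⟩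
    · rintro c s - ⟨p, hp, hps⟩
      exact ⟨c • p, Submodule.smul_mem _ c hp, fun y => by simp [hps]⟩
  obtain ⟨p, hp, hps⟩ := hext
  refine ⟨p, hp, fun y hy => ?_⟩
  have h1 := (ContinuousMap.dist_apply_le_dist (⟨y, abs_le.1 hy⟩ : Set.Icc (-r) r)).trans_lt hsf
  rw [dist_comm, Real.dist_eq, ← hps] at h1
  exact h1

end OneVariable

/-! ### Density of ridge fields among gradient fields -/

section RidgeFields

open Filter Topology MeasureTheory

variable {E : Type*} [NormedAddCommGroup E] [InnerProductSpace ℝ E]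

/-- The linear combinations of the fields `x ↦ g (⟪w, x⟫ + b) w`. For `g = σ'` these are the
gradients of the linear combinations of the ridge functions `x ↦ σ (⟪w, x⟫ + b)`. -/
def ridgeFields (E : Type*) [NormedAddCommGroup E] [InnerProductSpace ℝ E] (g : ℝ → ℝ) :
    Submodule ℝ (E → E) :=
  Submodule.span ℝ (Set.range fun (q : E × ℝ) (x : E) => g (inner ℝ q.1 x + q.2) • q.1)

/-- The field `F` is a limit of ridge fields, uniformly on bounded sets. -/
def IsRidgeLimit (g : ℝ → ℝ) (F : E → E) : Prop :=
  ∀ R : ℝ, ∀ ε > 0, ∃ G ∈ ridgeFields E g, ∀ x, ‖x‖ ≤ R → ‖G x - F x‖ ≤ ε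

theorem IsRidgeLimit.zero (g : ℝ → ℝ) : IsRidgeLimit g (0 : E → E) := fun _ ε hε =>
  ⟨0, Submodule.zero_mem _, fun x _ => by simpa using hε.le⟩

theorem IsRidgeLimit.add {g : ℝ → ℝ} {F₁ F₂ : E → E} (h₁ : IsRidgeLimit g F₁)
    (h₂ : IsRidgeLimit g F₂) : IsRidgeLimit g (F₁ + F₂) := by
  intro R ε hε
  obtain ⟨G₁, hG₁, h₁⟩ := h₁ R (ε / 2) (by positivity)
  obtain ⟨G₂, hG₂, h₂⟩ := h₂ R (ε / 2) (by positivity)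
  refine ⟨G₁ + G₂, Submodule.add_mem _ hG₁ hG₂, fun x hx => ?_⟩
  rw [Pi.add_apply, Pi.add_apply, add_sub_add_comm]
  linarith [norm_add_le (G₁ x - F₁ x) (G₂ x - F₂ x), h₁ x hx, h₂ x hx]

theorem IsRidgeLimit.const_smul {g : ℝ → ℝ} {F : E → E} (h : IsRidgeLimit g F) (c : ℝ) :
    IsRidgeLimit g (c • F) := by
  intro R ε hε
  obtain ⟨G, hG, h⟩ := h R (ε / (|c| + 1)) (by positivity)
  refine ⟨c • G, Submodule.smul_mem _ c hG, fun x hx => ?_⟩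
  rw [Pi.smul_apply, Pi.smul_apply, ← smul_sub, norm_smul, Real.norm_eq_abs]
  have := h x hx
  rw [le_div_iff₀ (by positivity)] at this
  nlinarith [norm_nonneg (G x - F x)]

theorem IsRidgeLimit.sum {g : ℝ → ℝ} {ι : Type*} (s : Finset ι) {F : ι → E → E}
    (h : ∀ i ∈ s, IsRidgeLimit g (F i)) : IsRidgeLimit g (∑ i ∈ s, F i) :=
  Finset.sum_induction F (IsRidgeLimit g) (fun _ _ => IsRidgeLimit.add) (IsRidgeLimit.zero g) h

/-- Every continuous profile `f` in place of `g` gives a limit of ridge fields. -/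
theorem isRidgeLimit_comp_inner_smul {g : ℝ → ℝ} (hg : Continuous g)
    (hpoly : ¬ ∃ P : Polynomial ℝ, ∀ x, g x = P.eval x) {f : ℝ → ℝ} (hf : Continuous f) (w : E) :
    IsRidgeLimit g fun x => f (inner ℝ w x) • w := by
  intro R ε hε
  obtain ⟨p, hp, hpf⟩ := exists_dilate_combination_close hg hpoly hf (‖w‖ * R)
    (show 0 < ε / (‖w‖ + 1) by positivity)
  refine ⟨fun x => p (inner ℝ w x) • w, ?_, fun x hx => ?_⟩
  · refine Submodule.span_induction
      (p := fun p _ => (fun x => p (inner ℝ w x) • w) ∈ ridgeFields E g) ?_ ?_ ?_ ?_ hp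
    · rintro _ ⟨⟨c, b⟩, rfl⟩
      -- The dilation factor `c ≠ 0` moves into the direction, which becomes `c • w`.
      have : (fun x : E => g (c * inner ℝ w x + b) • w)
          = (c : ℝ)⁻¹ • fun x => g (inner ℝ ((c : ℝ) • w) x + b) • ((c : ℝ) • w) := by
        ext1 x
        rw [Pi.smul_apply, real_inner_smul_left, smul_comm (g _) (c : ℝ) w, smul_smul,
          inv_mul_cancel₀ c.ne_zero, one_smul]
      simp only
      rw [this]
      exact Submodule.smul_mem _ _ (Submodule.subset_span ⟨((c : ℝ) • w, b), rfl⟩)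
    · simp only [Pi.zero_apply, zero_smul]
      exact Submodule.zero_mem _
    · intro p q _ _ hp hq
      simp only [Pi.add_apply, add_smul]
      exact Submodule.add_mem _ hp hq
    · intro c p _ hp
      simp only [Pi.smul_apply, smul_eq_mul, mul_smul]
      exact Submodule.smul_mem _ c hp
  · rw [← sub_smul, norm_smul, Real.norm_eq_abs]
    have h1 := (hpf _ ((abs_real_inner_le_norm w x).trans (by gcongr))).le
    rw [le_div_iff₀ (by positivity)] at h1
    nlinarith [abs_nonneg (p (inner ℝ w x) - f (inner ℝ w x))]

/-- By the Stone–Weierstrass theorem, sums of exponentials `x ↦ exp ⟪w, x⟫` approximate every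
continuous function uniformly on balls. -/
theorem exists_exp_sum_close [FiniteDimensional ℝ E] {κ : E → ℝ} (hκ : Continuous κ) (R : ℝ)
    {ε : ℝ} (hε : 0 < ε) :
    ∃ c : E →₀ ℝ, ∀ x, ‖x‖ ≤ R →
      |(c.sum fun w a => a * Real.exp (inner ℝ w x)) - κ x| < ε := by
  set K := Metric.closedBall (0 : E) R
  have : CompactSpace K := isCompact_iff_compactSpace.1 (isCompact_closedBall _ _)
  let e : Multiplicative E →* C(K, ℝ) :=
    { toFun := fun w => ⟨fun x => Real.exp (inner ℝ w.toAdd (x : E)), by fun_prop⟩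
      map_one' := by ext; simp
      map_mul' := fun v w => by ext; simp [inner_add_left, Real.exp_add] }
  set A := Algebra.adjoin ℝ (MonoidHom.mrange e : Set C(K, ℝ)) with hA
  have hsep : A.SeparatesPoints := by
    intro x y hxy
    refine ⟨_, ⟨e (Multiplicative.ofAdd ((x : E) - y)),
      Algebra.subset_adjoin ⟨_, rfl⟩, rfl⟩, fun heq => hxy ?_⟩
    have h1 := Real.exp_injective heq
    rw [toAdd_ofAdd, ← sub_eq_zero, ← inner_sub_right, inner_self_eq_zero, sub_eq_zero] at h1
    exact Subtype.ext h1
  obtain ⟨⟨p, hp⟩, hpκ⟩ := ContinuousMap.exists_mem_subalgebra_near_continuous_of_separatesPoints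
    A hsep (fun x : K => κ x) (by fun_prop) ε hε
  rw [← Subalgebra.mem_toSubmodule, hA, Algebra.adjoin_eq_span, Submonoid.closure_eq,
    MonoidHom.coe_mrange] at hp
  obtain ⟨c, rfl⟩ := Finsupp.mem_span_range_iff_exists_finsupp.1 hp
  refine ⟨c, fun x hx => ?_⟩
  have := hpκ ⟨x, mem_closedBall_zero_iff.2 hx⟩
  simp only [Finsupp.sum, ContinuousMap.sum_apply, ContinuousMap.smul_apply, smul_eq_mul] at this
  exact this

theorem continuous_gradient [CompleteSpace E] {H : E → ℝ} (hH : ContDiff ℝ 1 H) :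
    Continuous (gradient H) :=
  (InnerProductSpace.toDual ℝ E).symm.continuous.comp (hH.continuous_fderiv one_ne_zero)

theorem hasCompactSupport_gradient [CompleteSpace E] {H : E → ℝ} (hH : HasCompactSupport H) :
    HasCompactSupport (gradient H) :=
  (hH.fderiv ℝ).comp_left (g := (InnerProductSpace.toDual ℝ E).symm) (map_zero _)

variable [FiniteDimensional ℝ E] [MeasurableSpace E] [BorelSpace E]

/-- Integration by parts against an exponential. -/
theorem integral_exp_smul_gradient {H : E → ℝ} (hH : ContDiff ℝ 1 H) (hHs : HasCompactSupport H)
    (w : E) :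
    ∫ y, Real.exp (-inner ℝ w y) • gradient H y
      = (∫ y, Real.exp (-inner ℝ w y) * H y) • w := by
  have hgc := continuous_gradient hH
  have hgs := hasCompactSupport_gradient hHs
  have hexp : Continuous fun y : E => Real.exp (-inner ℝ w y) := by fun_prop
  have hexpd : ∀ y : E, HasFDerivAt (fun y : E => Real.exp (-inner ℝ w y))
      (Real.exp (-inner ℝ w y) • -(innerSL ℝ w)) y := fun y =>
    ((innerSL ℝ w).hasFDerivAt.neg (x := y)).exp
  have hgi : Integrable fun y => Real.exp (-inner ℝ w y) • gradient H y :=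
    (hexp.smul hgc).integrable_of_hasCompactSupport hgs.smul_left
  refine ext_inner_left ℝ fun v => ?_
  rw [← integral_inner hgi]
  have h1 : ∀ y, inner ℝ v (Real.exp (-inner ℝ w y) • gradient H y)
      = Real.exp (-inner ℝ w y) * fderiv ℝ H y v := fun y => by
    rw [real_inner_smul_right, inner_gradient_right]
    simp
  have h2 : ∀ y, fderiv ℝ (fun y : E => Real.exp (-inner ℝ w y)) y v * H y
      = -inner ℝ v w * (Real.exp (-inner ℝ w y) * H y) := fun y => by
    rw [(hexpd y).fderiv]
    simp [real_inner_comm v w]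
    ring
  have hint : Integrable fun y => Real.exp (-inner ℝ w y) * H y :=
    (hexp.mul hH.continuous).integrable_of_hasCompactSupport hHs.mul_left
  simp only [h1]
  rw [integral_mul_fderiv_eq_neg_fderiv_mul_of_integrable (μ := volume)]
  · simp only [h2]
    rw [integral_const_mul, real_inner_smul_right]
    ring
  · simp only [h2]
    exact hint.const_mul _
  · simp only [← h1]
    exact hgi.const_inner v
  · exact hint
  · exact fun y _ => (hexpd y).differentiableAt
  · exact fun y _ => (hH.differentiable one_ne_zero).differentiableAt

/-- Gradients of compactly supported functions are limits of ridge fields. Mollify the gradient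
with a bump `κ` and replace `κ` by a close sum `P` of exponentials: since
`exp ⟪w, x - y⟫ = exp ⟪w, x⟫ * exp (-⟪w, y⟫)`, the convolution `P ⋆ ∇H` is a finite sum of fields
`x ↦ d exp ⟪w, x⟫ w`. -/
theorem isRidgeLimit_gradient_of_hasCompactSupport {g : ℝ → ℝ} (hg : Continuous g)
    (hpoly : ¬ ∃ P : Polynomial ℝ, ∀ x, g x = P.eval x) {H : E → ℝ} (hH : ContDiff ℝ 1 H)
    (hHs : HasCompactSupport H) : IsRidgeLimit g (gradient H) := by
  intro R ε hε
  have hgc := continuous_gradient hH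
  have hgs := hasCompactSupport_gradient hHs
  have hgi : Integrable (gradient H) := hgc.integrable_of_hasCompactSupport hgs
  obtain ⟨R', hR'⟩ := hgs.isCompact.isBounded.exists_norm_le
  obtain ⟨ρ, hρ, hunif⟩ := Metric.uniformContinuous_iff.1
    (hgs.uniformContinuous_of_continuous hgc) (ε / 3) (by positivity)
  let φ : ContDiffBump (0 : E) := ⟨ρ / 2, ρ, by positivity, half_lt_self hρ⟩
  set κ := φ.normed (volume : Measure E)
  have hκ : Continuous κ := φ.continuous_normed
  set I := ∫ y, ‖gradient H y‖
  have hI : 0 ≤ I := integral_nonneg fun _ => norm_nonneg _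
  obtain ⟨c, hc⟩ := exists_exp_sum_close hκ (R + R') (show 0 < ε / 3 / (I + 1) by positivity)
  set P : E → ℝ := fun x => c.sum fun w a => a * Real.exp (inner ℝ w x)
  have hP : Continuous P := by
    simp only [P, Finsupp.sum]
    fun_prop
  have hsum : ∀ x, ∫ y, P (x - y) • gradient H y
      = ∑ w ∈ c.support, (c w * ∫ y, Real.exp (-inner ℝ w y) * H y)
        • Real.exp (inner ℝ w x) • w := by
    intro x
    have h1 : ∀ y, P (x - y) • gradient H y = ∑ w ∈ c.support, (c w * Real.exp (inner ℝ w x))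
        • Real.exp (-inner ℝ w y) • gradient H y := fun y => by
      simp only [P, Finsupp.sum, Finset.sum_smul, inner_sub_right, Real.exp_sub, Real.exp_neg,
        smul_smul, div_eq_mul_inv, mul_assoc]
    simp only [h1]
    rw [integral_finsetSum]
    · refine Finset.sum_congr rfl fun w _ => ?_
      rw [integral_smul, integral_exp_smul_gradient hH hHs, smul_smul, smul_smul]
      congr 1
      ring
    · intro w _
      refine Integrable.smul _ (Continuous.integrable_of_hasCompactSupport ?_ hgs.smul_left)
      fun_prop
  have hlim : IsRidgeLimit g fun x => ∫ y, P (x - y) • gradient H y := by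
    have h1 := IsRidgeLimit.sum c.support fun w _ =>
      (isRidgeLimit_comp_inner_smul hg hpoly Real.continuous_exp w).const_smul
        (c w * ∫ y, Real.exp (-inner ℝ w y) * H y)
    convert h1 using 1
    ext1 x
    rw [hsum, Finset.sum_apply]
    rfl
  obtain ⟨G, hG, hGP⟩ := hlim R (ε / 3) (by positivity)
  refine ⟨G, hG, fun x hx => ?_⟩
  have h1 : ‖(∫ y, κ (x - y) • gradient H y) - gradient H x‖ ≤ ε / 3 := by
    rw [← convolution_lsmul_swap (𝕜 := ℝ) (μ := (volume : Measure E)), ← dist_eq_norm]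
    exact φ.dist_normed_convolution_le hgc.aestronglyMeasurable fun y hy => (hunif hy).le
  have h2 : ‖(∫ y, P (x - y) • gradient H y) - ∫ y, κ (x - y) • gradient H y‖ ≤ ε / 3 := by
    have hPi : Integrable fun y => P (x - y) • gradient H y :=
      Continuous.integrable_of_hasCompactSupport (by fun_prop) hgs.smul_left
    have hκi : Integrable fun y => κ (x - y) • gradient H y :=
      Continuous.integrable_of_hasCompactSupport (by fun_prop) hgs.smul_left
    rw [← integral_sub hPi hκi]
    have h3 : ∀ y, ‖P (x - y) • gradient H y - κ (x - y) • gradient H y‖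
        ≤ ε / 3 / (I + 1) * ‖gradient H y‖ := by
      intro y
      rw [← sub_smul, norm_smul]
      rcases eq_or_ne (gradient H y) 0 with h0 | h0
      · simp [h0]
      · gcongr
        refine (hc (x - y) ((norm_sub_le _ _).trans (add_le_add hx (hR' y ?_)))).le
        exact subset_tsupport _ h0
    refine (norm_integral_le_of_norm_le (hgi.norm.const_mul _)
      (Eventually.of_forall h3)).trans ?_
    rw [integral_const_mul, div_mul_eq_mul_div, div_le_iff₀ (by positivity)]
    exact mul_le_mul_of_nonneg_left (by linarith) (by positivity)
  have h4 := hGP x hx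
  have h5 := norm_sub_le_norm_sub_add_norm_sub (G x) (∫ y, P (x - y) • gradient H y) (gradient H x)
  have h6 := norm_sub_le_norm_sub_add_norm_sub (∫ y, P (x - y) • gradient H y)
    (∫ y, κ (x - y) • gradient H y) (gradient H x)
  linarith

/-- Universal approximation of gradients: the gradient of a `C¹` function is, uniformly on bounded
sets, a limit of linear combinations of fields `x ↦ g (⟪w, x⟫ + b) w` if `g` is continuous and not
a polynomial. -/
theorem isRidgeLimit_gradient {g : ℝ → ℝ} (hg : Continuous g)
    (hpoly : ¬ ∃ P : Polynomial ℝ, ∀ x, g x = P.eval x) {H : E → ℝ} (hH : ContDiff ℝ 1 H) :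
    IsRidgeLimit g (gradient H) := by
  intro R ε hε
  let χ : ContDiffBump (0 : E) := ⟨|R| + 1, |R| + 2, by positivity, by linarith⟩
  have hχH : ContDiff ℝ 1 fun x => χ x * H x := χ.contDiff.mul hH
  obtain ⟨G, hG, h⟩ := isRidgeLimit_gradient_of_hasCompactSupport hg hpoly hχH
    χ.hasCompactSupport.mul_right R ε hε
  refine ⟨G, hG, fun x hx => ?_⟩
  have heq : (fun x => χ x * H x) =ᶠ[𝓝 x] H := by
    have hmem : x ∈ Metric.ball (0 : E) χ.rIn := by
      rw [mem_ball_zero_iff]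
      change ‖x‖ < |R| + 1
      linarith [le_abs_self R]
    filter_upwards [χ.eventuallyEq_one_of_mem_ball hmem] with y hy
    rw [hy, Pi.one_apply, one_mul]
  rw [← heq.gradient_eq]
  exact h x hx

end RidgeFields

/-! ### Networks and their layers -/

section Networks

open Filter Topology

theorem iteratedDeriv_polynomial_eval (k : ℕ) (P : Polynomial ℝ) :
    iteratedDeriv k (fun x => P.eval x) = fun x => (Polynomial.derivative^[k] P).eval x := by
  induction k generalizing P with
  | zero => simp
  | succ k ih =>
    have h : deriv (fun x => P.eval x) = fun x => (Polynomial.derivative P).eval x := by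
      ext x
      exact P.deriv
    rw [iteratedDeriv_succ', h, ih, Function.iterate_succ_apply]

theorem not_exists_polynomial_deriv {σ : ℝ → ℝ} (hσ : ContDiff ℝ 1 σ)
    (hpoly : ¬ ∃ P : Polynomial ℝ, ∀ y : ℝ, σ y = P.eval y) :
    ¬ ∃ P : Polynomial ℝ, ∀ y : ℝ, deriv σ y = P.eval y := by
  rintro ⟨P, hP⟩
  replace hP : deriv σ = fun y => P.eval y := funext hP
  have hsm : ContDiff ℝ ((P.natDegree + 2 : ℕ) : WithTop ℕ∞) σ := by
    have hd : ContDiff ℝ ((P.natDegree + 1 : ℕ) : WithTop ℕ∞) (deriv σ) := by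
      rw [hP]
      simpa only [Polynomial.coe_aeval_eq_eval] using P.contDiff_aeval (𝕜 := ℝ) _
    have := contDiff_succ_iff_deriv.2
      ⟨hσ.differentiable one_ne_zero, fun h => (WithTop.natCast_ne_top _ h).elim, hd⟩
    exact_mod_cast this
  obtain ⟨Q, -, hQ⟩ := exists_polynomial_of_iteratedDeriv_eq_zero hsm fun x => by
    rw [iteratedDeriv_succ', hP, iteratedDeriv_polynomial_eval,
      Polynomial.iterate_derivative_eq_zero (Nat.lt_succ_self _)]
    exact Polynomial.eval_zero
  exact hpoly ⟨Q, hQ⟩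

variable {n : ℕ}

/-- Multiplication by `J`, as a continuous linear map of the phase space. -/
noncomputable def symplecticJ (n : ℕ) : PhaseSpace n →L[ℝ] PhaseSpace n :=
  LinearMap.toContinuousLinearMap (Matrix.toEuclideanLin (Matrix.J (Fin n) ℝ))

theorem hamiltonianField_apply (H : PhaseSpace n → ℝ) (x : PhaseSpace n) :
    hamiltonianField H x = symplecticJ n (gradient H x) := rfl

/-- `J` is skew-symmetric. -/
theorem inner_symplecticJ_self (x : PhaseSpace n) : inner ℝ x (symplecticJ n x) = 0 := by
  have h1 : symplecticJ n x = WithLp.toLp 2 ((Matrix.J (Fin n) ℝ).mulVec x.ofLp) :=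
    Matrix.toLpLin_apply 2 2 _ x
  rw [h1, EuclideanSpace.inner_eq_star_dotProduct, star_trivial]
  have h2 : ((Matrix.J (Fin n) ℝ).mulVec x.ofLp) ⬝ᵥ x.ofLp
      = -(((Matrix.J (Fin n) ℝ).mulVec x.ofLp) ⬝ᵥ x.ofLp) := by
    conv_lhs => rw [dotProduct_comm, Matrix.dotProduct_mulVec, ← Matrix.mulVec_transpose,
      Matrix.J_transpose, Matrix.neg_mulVec, neg_dotProduct]
  simpa using self_eq_neg.1 h2

theorem hamiltonianField_ridge {σ : ℝ → ℝ} (hσ : ContDiff ℝ 1 σ) (a b : ℝ) (w x : PhaseSpace n) :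
    hamiltonianField (fun x => a * σ (inner ℝ w x + b)) x
      = (a * deriv σ (inner ℝ w x + b)) • symplecticJ n w := by
  have h1 : HasFDerivAt (fun x : PhaseSpace n => inner ℝ w x + b) (innerSL ℝ w) x :=
    (innerSL ℝ w).hasFDerivAt.add_const b
  have h2 : HasDerivAt σ (deriv σ (inner ℝ w x + b)) (inner ℝ w x + b) :=
    (hσ.differentiable one_ne_zero _).hasDerivAt
  have h3 : HasGradientAt (fun x : PhaseSpace n => a * σ (inner ℝ w x + b))
      ((a * deriv σ (inner ℝ w x + b)) • w) x := by
    rw [hasGradientAt_iff_hasFDerivAt]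
    refine ((h2.comp_hasFDerivAt x h1).const_mul a).congr_fderiv ?_
    ext v
    simp [mul_assoc]
  rw [hamiltonianField_apply, h3.gradient, map_smul]

/-- The flow of a ridge Hamiltonian is a shear: along integral curves `⟪w, γ⟫` is constant since
`⟪w, J w⟫ = 0`, so the field is constant along them. -/
theorem isHamiltonianFlow_ridge {σ : ℝ → ℝ} (hσ : ContDiff ℝ 1 σ) (a b : ℝ) (w : PhaseSpace n)
    (h : ℝ) :
    IsHamiltonianFlow (fun x => a * σ (inner ℝ w x + b)) h Set.univ
      (fun x => x + (h * (a * deriv σ (inner ℝ w x + b))) • symplecticJ n w) := by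
  intro x _
  set c := a * deriv σ (inner ℝ w x + b) with hc
  have hinv : ∀ s : ℝ, inner ℝ w (x + s • symplecticJ n w) = inner ℝ w x := fun s => by
    rw [inner_add_right, real_inner_smul_right, inner_symplecticJ_self, mul_zero, add_zero]
  have huniq : ∀ τ : ℝ, ∀ γ : ℝ → PhaseSpace n, γ 0 = x →
      IsIntegralCurveOn γ (fun _ => hamiltonianField fun x => a * σ (inner ℝ w x + b))
        (Set.uIcc 0 τ) →
      ∀ t ∈ Set.uIcc 0 τ, γ t = x + (t * c) • symplecticJ n w := by
    intro τ γ h0 hγ t ht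
    have hder : ∀ s ∈ Set.uIcc 0 τ, HasDerivWithinAt γ
        ((a * deriv σ (inner ℝ w (γ s) + b)) • symplecticJ n w) (Set.uIcc 0 τ) s := by
      intro s hs
      rw [← hamiltonianField_ridge hσ]
      exact hγ s hs
    have hconst : ∀ s ∈ Set.uIcc 0 τ, inner ℝ w (γ s) = inner ℝ w x := by
      intro s hs
      have h1 : ∀ s ∈ Set.uIcc 0 τ,
          HasDerivWithinAt (fun s => inner ℝ w (γ s)) 0 (Set.uIcc 0 τ) s := by
        intro s hs
        have := (innerSL ℝ w).hasFDerivAt.comp_hasDerivWithinAt s (hder s hs)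
        rw [map_smul, innerSL_apply_apply, inner_symplecticJ_self, smul_zero] at this
        exact this
      have h2 := Convex.norm_image_sub_le_of_norm_hasDerivWithin_le (C := 0) h1 (by simp)
        (convex_uIcc 0 τ) Set.left_mem_uIcc hs
      rw [zero_mul, norm_le_zero_iff, sub_eq_zero, h0] at h2
      exact h2
    have h1 : ∀ s ∈ Set.uIcc 0 τ, HasDerivWithinAt
        (fun s => γ s - (s * c) • symplecticJ n w) 0 (Set.uIcc 0 τ) s := by
      intro s hs
      have h2 := hder s hs
      rw [hconst s hs, ← hc] at h2
      have h3 := (((hasDerivWithinAt_id s (Set.uIcc 0 τ)).mul_const c).smul_const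
        (symplecticJ n w))
      have h4 := h2.sub h3
      rw [one_mul, sub_self] at h4
      exact h4
    have h2 := Convex.norm_image_sub_le_of_norm_hasDerivWithin_le (C := 0) h1 (by simp)
      (convex_uIcc 0 τ) Set.left_mem_uIcc ht
    simp only [zero_mul, zero_smul, sub_zero, norm_le_zero_iff, h0] at h2
    rwa [sub_eq_zero, sub_eq_iff_eq_add] at h2
  refine ⟨⟨fun t => x + (t * c) • symplecticJ n w, by simp, rfl, fun t _ => ?_⟩, ?_⟩
  · have h1 : HasDerivAt (fun t : ℝ => x + (t * c) • symplecticJ n w)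
        ((1 * c) • symplecticJ n w) t :=
      (((hasDerivAt_id t).mul_const c).smul_const _).const_add x
    simp only
    rw [hamiltonianField_ridge hσ, hinv, ← hc, ← one_mul c]
    simpa using h1.hasDerivWithinAt
  · intro τ _ γ₁ γ₂ h₁ h₂ hγ₁ hγ₂ t ht
    rw [huniq τ γ₁ h₁ hγ₁ t ht, huniq τ γ₂ h₂ hγ₂ t ht]

/-- Every shear `x ↦ x + s σ'(⟪w, x⟫ + b) J w` is a layer of width `m ≥ 1`: with one active unit,
of weight `a = s / h`. -/
theorem isRSympNet_shear {σ : ℝ → ℝ} (hσ : ContDiff ℝ 1 σ) {m : ℕ} (hm : 1 ≤ m) {h : ℝ}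
    (hh : h ≠ 0) (s b : ℝ) (w : PhaseSpace n) :
    IsRSympNet σ m h 1
      (fun x => x + s • (deriv σ (inner ℝ w x + b) • symplecticJ n w)) := by
  have hmem : (fun x => s / h * σ (inner ℝ w x + b)) ∈ ridgeHamiltonians n σ m := by
    refine ⟨Pi.single ⟨0, hm⟩ (s / h), fun _ => b, w, ?_⟩
    ext1 x
    rw [← Finset.sum_mul, Finset.sum_pi_single']
    simp
  have heq : (fun x : PhaseSpace n => x + s • (deriv σ (inner ℝ w x + b) • symplecticJ n w))
      = fun x => x + (h * (s / h * deriv σ (inner ℝ w x + b))) • symplecticJ n w := by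
    ext1 x
    rw [← mul_assoc, mul_div_cancel₀ _ hh, smul_smul]
  rw [heq]
  exact IsSympNet.single hmem (isHamiltonianFlow_ridge hσ (s / h) b w h)

theorem IsRSympNet.comp {σ : ℝ → ℝ} {m : ℕ} {h : ℝ} {k l : ℕ} {Φ Ψ : PhaseSpace n → PhaseSpace n}
    (hΦ : IsRSympNet σ m h k Φ) (hΨ : IsRSympNet σ m h l Ψ) :
    IsRSympNet σ m h (k + l) (Ψ ∘ Φ) := by
  induction hΨ with
  | single hH hφ => exact IsSympNet.comp hΦ hH hφ
  | @comp _ Θ _ _ _ hH hφ ih => exact IsSympNet.comp (Φ := Θ ∘ Φ) ih hH hφ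

theorem IsRSympNet.iterate {σ : ℝ → ℝ} {m : ℕ} {h : ℝ} {k : ℕ} {Φ : PhaseSpace n → PhaseSpace n}
    (hΦ : IsRSympNet σ m h k Φ) (N : ℕ) : ∃ l, IsRSympNet σ m h l (Φ^[N + 1]) := by
  induction N with
  | zero => exact ⟨k, hΦ⟩
  | succ N ih =>
    obtain ⟨l, hl⟩ := ih
    rw [Function.iterate_succ']
    exact ⟨l + k, hl.comp hΦ⟩

/-- For every ridge field `F`, some family of R-SympNets is a consistent one-step method for the
field `J F`. -/
theorem exists_isRSympNet_isConsistent {σ : ℝ → ℝ} (hσ : ContDiff ℝ 1 σ) {m : ℕ} (hm : 1 ≤ m)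
    {h : ℝ} (hh : h ≠ 0) {F : PhaseSpace n → PhaseSpace n}
    (hF : F ∈ ridgeFields (PhaseSpace n) (deriv σ)) :
    Continuous F ∧ ∃ f : ℝ → PhaseSpace n → PhaseSpace n,
      (∀ τ, ∃ k, IsRSympNet σ m h k (f τ)) ∧ IsConsistent f (symplecticJ n ∘ F) := by
  have hσ' : Continuous (deriv σ) := hσ.continuous_deriv le_rfl
  refine Submodule.span_induction (p := fun F _ => Continuous F ∧
    ∃ f : ℝ → PhaseSpace n → PhaseSpace n, (∀ τ, ∃ k, IsRSympNet σ m h k (f τ)) ∧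
      IsConsistent f (symplecticJ n ∘ F)) ?_ ?_ ?_ ?_ hF
  · rintro _ ⟨⟨w, b⟩, rfl⟩
    refine ⟨by fun_prop, _, fun τ => ⟨1, isRSympNet_shear hσ hm hh τ b w⟩, ?_⟩
    convert isConsistent_add_smul _ using 1
    ext1 x
    simp
  · refine ⟨continuous_zero, _, fun τ => ⟨1, isRSympNet_shear hσ hm hh τ 0 0⟩, ?_⟩
    convert isConsistent_add_smul _ using 1
    ext1 x
    simp
  · rintro F₁ F₂ - - ⟨hc₁, f₁, hf₁, hcons₁⟩ ⟨hc₂, f₂, hf₂, hcons₂⟩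
    refine ⟨hc₁.add hc₂, fun τ => f₂ τ ∘ f₁ τ, fun τ => ?_, ?_⟩
    · obtain ⟨k, hk⟩ := hf₁ τ
      obtain ⟨l, hl⟩ := hf₂ τ
      exact ⟨k + l, hk.comp hl⟩
    · convert hcons₁.comp hcons₂ ((symplecticJ n).continuous.comp hc₁)
        ((symplecticJ n).continuous.comp hc₂) using 1
      ext1 x
      simp
  · rintro c F - ⟨hc, f, hf, hcons⟩
    refine ⟨hc.const_smul c, fun τ => f (c * τ), fun τ => hf _, ?_⟩
    convert hcons.const_smul c using 1
    ext1 x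
    simp

/-- A flow for time `h ≠ 0`, with its uniqueness, becomes the time-one flow of the field scaled
by `h`. -/
theorem IsHamiltonianFlow.exists_unit_time {H : PhaseSpace n → ℝ} {h : ℝ} (hh : h ≠ 0)
    {Ω : Set (PhaseSpace n)} {φ : PhaseSpace n → PhaseSpace n} (hφ : IsHamiltonianFlow H h Ω φ)
    {x : PhaseSpace n} (hx : x ∈ Ω) :
    ∃ γ : ℝ → PhaseSpace n, γ 0 = x ∧ γ 1 = φ x ∧
      IsIntegralCurveOn γ (fun _ => h • hamiltonianField H) (Set.Icc 0 1) ∧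
      ∀ τ ∈ Set.Icc (0 : ℝ) 1, ∀ z : ℝ → PhaseSpace n, z 0 = x →
        IsIntegralCurveOn z (fun _ => h • hamiltonianField H) (Set.Icc 0 τ) →
        Set.EqOn z γ (Set.Icc 0 τ) := by
  obtain ⟨⟨γ, h0, h1, hγ⟩, huniq⟩ := hφ x hx
  have hmaps : ∀ τ : ℝ, ∀ t ∈ Set.Icc 0 τ, t * h ∈ Set.uIcc 0 (τ * h) := by
    intro τ t ht
    rcases le_total 0 h with hs | hs
    · exact Set.mem_uIcc_of_le (mul_nonneg ht.1 hs) (mul_le_mul_of_nonneg_right ht.2 hs)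
    · exact Set.mem_uIcc_of_ge (mul_le_mul_of_nonpos_right ht.2 hs)
        (mul_nonpos_of_nonneg_of_nonpos ht.1 hs)
  have hmaps' : ∀ τ : ℝ, 0 ≤ τ → ∀ t ∈ Set.uIcc 0 (τ * h), t * h⁻¹ ∈ Set.Icc 0 τ := by
    intro τ hτ t ht
    rw [← div_eq_mul_inv]
    rcases hh.lt_or_gt with hs | hs
    · rw [Set.uIcc_of_ge (mul_nonpos_of_nonneg_of_nonpos hτ hs.le)] at ht
      exact ⟨div_nonneg_of_nonpos ht.2 hs.le, (div_le_iff_of_neg hs).2 ht.1⟩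
    · rw [Set.uIcc_of_le (mul_nonneg hτ hs.le)] at ht
      exact ⟨div_nonneg ht.1 hs.le, (div_le_iff₀ hs).2 ht.2⟩
  refine ⟨γ ∘ (· * h), by simpa using h0, by simpa using h1, ?_, ?_⟩
  · exact (hγ.comp_mul h).mono fun t ht => by simpa using hmaps 1 t ht
  · intro τ hτ z hz0 hz t ht
    have hτh : τ * h ∈ Set.uIcc 0 h := by simpa using hmaps 1 τ hτ
    have hz' : IsIntegralCurveOn (z ∘ (· * h⁻¹)) (fun _ => hamiltonianField H)
        (Set.uIcc 0 (τ * h)) := by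
      have := (hz.comp_mul h⁻¹).mono (hmaps' τ hτ.1)
      intro s hs
      have h2 := this s hs
      simp only [Pi.smul_apply, Function.comp_apply, smul_smul, inv_mul_cancel₀ hh,
        one_smul] at h2
      exact h2
    have := huniq (τ * h) hτh (z ∘ (· * h⁻¹)) γ (by simpa using hz0) h0 hz'
      (hγ.mono (Set.uIcc_subset_uIcc_left hτh)) (hmaps τ t ht)
    simp only [Function.comp_apply, mul_assoc, mul_inv_cancel₀ hh, mul_one] at this
    exact this

end Networks

theorem mainTheorem4 (n : ℕ) (σ : ℝ → ℝ) (hσ : ContDiff ℝ 1 σ)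
    (hσ_nonpoly : ¬ ∃ P : Polynomial ℝ, ∀ y : ℝ, σ y = P.eval y)
    (m : ℕ) (hm : 1 ≤ m)
    (H : PhaseSpace n → ℝ) (hH : ContDiff ℝ 1 H)
    (h : ℝ) (Ω : Set (PhaseSpace n)) (hΩ : IsCompact Ω)
    (φ : PhaseSpace n → PhaseSpace n) (hφ : IsHamiltonianFlow H h Ω φ)
    (ε : ℝ) (hε : 0 < ε) :
    ∃ (k : ℕ) (Φ : PhaseSpace n → PhaseSpace n),
      IsRSympNet σ m h k Φ ∧ ∀ x ∈ Ω, ‖Φ x - φ x‖ < ε := by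
  rcases eq_or_ne h 0 with rfl | hh
  · -- For `h = 0` every layer, like the flow itself, is the identity.
    have hmem : (fun x => 0 * σ (inner ℝ 0 x + 0)) ∈ ridgeHamiltonians n σ m :=
      ⟨0, 0, 0, by simp⟩
    refine ⟨1, _, IsSympNet.single hmem (isHamiltonianFlow_ridge hσ 0 0 0 0), fun x hx => ?_⟩
    obtain ⟨⟨γ, h0, h1, -⟩, -⟩ := hφ x hx
    rw [← h1, h0]
    simpa using hε
  have hcont : Continuous (h • hamiltonianField H) :=
    ((symplecticJ n).continuous.comp (continuous_gradient hH)).const_smul h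
  obtain ⟨R, δ, hδ, N₀, hclose⟩ := exists_iterate_close_of_isCompact hcont hΩ
    (fun x hx => hφ.exists_unit_time hh hx) hε
  set C := |h| * ‖symplecticJ n‖
  have hC : 0 ≤ C := by positivity
  obtain ⟨G, hG, hGH⟩ := isRidgeLimit_gradient (hσ.continuous_deriv le_rfl)
    (not_exists_polynomial_deriv hσ hσ_nonpoly) hH R (δ / 2 / (C + 1)) (by positivity)
  obtain ⟨-, f, hf, hcons⟩ := exists_isRSympNet_isConsistent hσ hm hh hG
  obtain ⟨τ₀, hτ₀, hstep⟩ := hcons.const_smul h R (δ / 2) (by positivity)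
  obtain ⟨N₁, hN₁⟩ := exists_nat_one_div_lt hτ₀
  -- `N + 1` steps of length `1 / (N + 1) ≤ τ₀`.
  set N := max N₀ N₁
  obtain ⟨k, hk⟩ := hf (h * (1 / ((N + 1 : ℕ) : ℝ)))
  obtain ⟨l, hl⟩ := hk.iterate N
  refine ⟨l, _, hl, hclose (N + 1) ((le_max_left _ _).trans (Nat.le_succ _)) _ fun x hx => ?_⟩
  set τ : ℝ := 1 / ((N + 1 : ℕ) : ℝ) with hτ
  have hτpos : 0 < τ := by positivity
  have hττ₀ : |τ| ≤ τ₀ := by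
    rw [abs_of_pos hτpos, hτ]
    refine le_trans ?_ hN₁.le
    push_cast
    gcongr
    exact_mod_cast le_max_right _ _
  have h1 := hstep τ hττ₀ x hx
  have h2 : ‖τ • (h • symplecticJ n (G x - gradient H x))‖ ≤ δ / 2 * τ := by
    rw [norm_smul, norm_smul, Real.norm_of_nonneg hτpos.le, Real.norm_eq_abs, mul_comm]
    refine mul_le_mul_of_nonneg_right ?_ hτpos.le
    have h3 := hGH x hx
    rw [le_div_iff₀ (by positivity)] at h3
    calc |h| * ‖symplecticJ n (G x - gradient H x)‖
        ≤ |h| * (‖symplecticJ n‖ * ‖G x - gradient H x‖) := by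
          gcongr
          exact (symplecticJ n).le_opNorm _
      _ = ‖G x - gradient H x‖ * C := by ring
      _ ≤ δ / 2 := by nlinarith [norm_nonneg (G x - gradient H x)]
  rw [abs_of_pos hτpos] at h1
  have h3 : f (h * τ) x - x - τ • (h • hamiltonianField H) x
      = (f (h * τ) x - x - τ • (h • symplecticJ n ∘ G) x)
        + τ • (h • symplecticJ n (G x - gradient H x)) := by
    simp only [Pi.smul_apply, Function.comp_apply, hamiltonianField_apply, map_sub, smul_sub]
    abel
  rw [h3]
  refine (norm_add_le _ _).trans ?_
  have h4 : δ / ((N + 1 : ℕ) : ℝ) = δ / 2 * τ + δ / 2 * τ := by rw [hτ]; ring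
  rw [h4]
  exact add_le_add h1 h2
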